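/- Let $(X,\omega)$ be a finite-dimensional real symplectic vector space, and let $C\subseteq X$ be a coisotropic subspace, i.e. $C^\perp\subseteq C$, where $\perp$ denotes the $\omega$-orthogonal. Let $X^C=C/C^\perp$ be the reduced symplectic space and $r=\dim C^\perp$. For a finite-dimensional real symplectic vector space $V$, let $\mathcal L(V)$ be the Lagrangian Grassmannian of $V$ with its usual topology, and put $d(L,L')=\dim L-\dim(L\cap L')$ for $L,L'\in\mathcal L(V)$. Let $\mathcal L_\bullet(V)=\mathcal L(V)\times\mathbb Z_{\ge 0}$, and for $(L,k)\in\mathcal L_\bullet(V)$ put $$S(L,k)=\{(L',j)\in\mathcal L_\bullet(V) : d(L,L')\le k-j\}.$$ The Sabot topology on $\mathcal L_\bullet(V)$ is the topology generated by the sets $\bigcup_{L\in\mathcal U}S(L,k)$, where $k\ge 0$ and $\mathcal U\subseteq\mathcal L(V)$ is open. Let $\mathcal L_{\le r}(V)=\{(L,k)\in\mathcal L_\bullet(V) : k\le r\}$, with the subspace topology induced by the Sabot topology. Theorem. The map $$\rho^C_\bullet:\mathcal L(X)\to\mathcal L_{\le r}(X^C),\qquad \rho^C_\bullet(L)=\bigl((L\cap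 C)/(L\cap C^\perp),\ \dim(L\cap C^\perp)\bigr),$$ where $(L\cap C)/(L\cap C^\perp)$ is regarded as a Lagrangian subspace of $X^C$ (the image of $L\cap C$ under $C\to C/C^\perp$), is surjective, continuous and open. Consequently the restricted Sabot topology on $\mathcal L_{\le r}(X^C)$ is the quotient topology, via $\rho^C_\bullet$, of the usual topology on $\mathcal L(X)$. -/

import Mathlib

open LinearMap (BilinForm)

namespace Symplectic

section Lagrangian

variable {X : Type*} [AddCommGroup X] [Module ℝ X]

/-- A symplectic form: a nondegenerate alternating bilinear form. -/
structure IsSymplectic (ω : BilinForm ℝ X) : Prop where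
  alt : ω.IsAlt
  nondegenerate : ω.Nondegenerate

/-- `C` is coisotropic if it contains its symplectic orthogonal `C^⊥`. -/
def IsCoisotropic (ω : BilinForm ℝ X) (C : Submodule ℝ X) : Prop :=
  ω.orthogonal C ≤ C

/-- `L` is Lagrangian if it equals its symplectic orthogonal. -/
def IsLagrangian (ω : BilinForm ℝ X) (L : Submodule ℝ X) : Prop :=
  ω.orthogonal L = L

/-- The Lagrangian Grassmannian `𝓛(X)`: the set of all Lagrangian subspaces of `X`. -/
def LagrangianGrassmannian (ω : BilinForm ℝ X) : Type _ :=
  {L : Submodule ℝ X // IsLagrangian ω L}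

variable (X) in
/-- The space of `d`-frames in `X`: linearly independent `d`-tuples of vectors. -/
def Frame (d : ℕ) : Type _ := {v : Fin d → X // LinearIndependent ℝ v}

/-- The topology on the space of frames as a subspace of the vector space `X ^ d`, which carries
its canonical topology (for a finite-dimensional space, the unique Hausdorff vector space
topology). -/
instance (d : ℕ) : TopologicalSpace (Frame X d) :=
  TopologicalSpace.induced Subtype.val (moduleTopology ℝ (Fin d → X))

/-- The subspace spanned by a frame. -/
def Frame.span {d : ℕ} (v : Frame X d) : Submodule ℝ X := Submodule.span ℝ (Set.range v.1)

variable (X) in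
/-- The usual topology on the set of all (finite-dimensional) subspaces of `X`: the disjoint union
over `d` of the Grassmannians `Gr(d, X)`, each with the quotient topology from the `d`-frames.
A set of subspaces is open iff, for every `d`, the set of `d`-frames spanning one of its
members is open. -/
abbrev grassmannTopology : TopologicalSpace (Submodule ℝ X) :=
  ⨆ d : ℕ, TopologicalSpace.coinduced (Frame.span (X := X) (d := d)) inferInstance

/-- The usual topology on `𝓛(X)`, as a subspace of the Grassmannian. -/
instance (ω : BilinForm ℝ X) : TopologicalSpace (LagrangianGrassmannian ω) :=
  TopologicalSpace.induced Subtype.val (grassmannTopology X)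

/-- The discrete metric `d(L, L') = codim (L ∩ L', L)`. -/
noncomputable def lagrangianDist {ω : BilinForm ℝ X} (L L' : LagrangianGrassmannian ω) : ℕ :=
  Module.finrank ℝ (L.1 ⧸ (L.1 ⊓ L'.1).submoduleOf L.1)

/-- The indexed Lagrangian Grassmannian `𝓛_•(X) = 𝓛(X) × ℕ`, with elements `(L, k)`. -/
@[ext]
structure IndexedLagrangian (ω : BilinForm ℝ X) where
  /-- the Lagrangian subspace -/
  lagrangian : LagrangianGrassmannian ω
  /-- the index -/
  index : ℕ

/-- The sublevel set `S(L, k) = {(L', j) | d(L, L') ≤ k - j}`; the inequality, between integers,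
is written with `j` on the left. -/
def sublevel {ω : BilinForm ℝ X} (p : IndexedLagrangian ω) : Set (IndexedLagrangian ω) :=
  {q | lagrangianDist p.lagrangian q.lagrangian + q.index ≤ p.index}

/-- The Sabot topology on `𝓛_•(X)`, generated by the sublevel sets
`S(U × {k}) = ⋃ L ∈ U, S(L, k)` of the open subsets `U × {k}` of the levels. -/
instance sabotTopology (ω : BilinForm ℝ X) : TopologicalSpace (IndexedLagrangian ω) :=
  TopologicalSpace.generateFrom
    {V | ∃ (k : ℕ) (U : Set (LagrangianGrassmannian ω)), IsOpen U ∧ V = ⋃ L ∈ U, sublevel ⟨L, k⟩}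

/-- The truncated indexed Lagrangian Grassmannian `𝓛_{≤ r}(X)`: the levels up to `r`. As a
subtype it carries the restricted Sabot topology. -/
abbrev TruncatedIndexedLagrangian (ω : BilinForm ℝ X) (r : ℕ) : Type _ :=
  {p : IndexedLagrangian ω // p.index ≤ r}

end Lagrangian

section Reduction

variable {X : Type*} [AddCommGroup X] [Module ℝ X]

/-- The reduced space `X^C = C / C^⊥` (where `C^⊥ ⊆ C` if `C` is coisotropic). -/
abbrev ReducedSpace (ω : BilinForm ℝ X) (C : Submodule ℝ X) : Type _ :=
  C ⧸ (ω.orthogonal C).submoduleOf C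

theorem restrict_isRefl {ω : BilinForm ℝ X} (hω : IsSymplectic ω) (C : Submodule ℝ X) :
    LinearMap.IsRefl (ω.restrict C) :=
  fun x y h => hω.alt.isRefl x y h

theorem orthogonal_le_ker_restrict {ω : BilinForm ℝ X} (hω : IsSymplectic ω)
    (C : Submodule ℝ X) :
    (ω.orthogonal C).submoduleOf C ≤ LinearMap.ker (ω.restrict C) := by
  intro x hx
  refine LinearMap.ext fun y => ?_
  exact hω.alt.isRefl _ _ (hx y.1 y.2)

/-- The reduced form on `X^C`, given by `ω^C([x], [y]) = ω(x, y)` for `x, y ∈ C`. -/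
def reducedForm {ω : BilinForm ℝ X} (hω : IsSymplectic ω) (C : Submodule ℝ X) :
    BilinForm ℝ (ReducedSpace ω C) :=
  LinearMap.IsRefl.liftQ₂ (ω.restrict C) ((ω.orthogonal C).submoduleOf C)
    (restrict_isRefl hω C) (orthogonal_le_ker_restrict hω C)

theorem reducedForm_mk {ω : BilinForm ℝ X} (hω : IsSymplectic ω) (C : Submodule ℝ X) (x y : C) :
    reducedForm hω C (Submodule.Quotient.mk x) (Submodule.Quotient.mk y) = ω x y :=
  rfl

/-- The reduced form is again symplectic. -/
theorem reducedForm_isSymplectic {ω : BilinForm ℝ X} (hω : IsSymplectic ω) (C : Submodule ℝ X) :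
    IsSymplectic (reducedForm hω C) := by
  have halt : (reducedForm hω C).IsAlt := by
    intro x
    obtain ⟨x, rfl⟩ := Submodule.Quotient.mk_surjective _ x
    exact hω.alt x
  have hright : (reducedForm hω C).SeparatingRight := by
    intro x hx
    obtain ⟨x, rfl⟩ := Submodule.Quotient.mk_surjective _ x
    refine (Submodule.Quotient.mk_eq_zero _).2 fun y hy => ?_
    exact hx (Submodule.Quotient.mk ⟨y, hy⟩)
  exact ⟨halt, fun x hx => hright x fun y => halt.isRefl _ _ (hx y), hright⟩

/-- The reduction `L^C = (L ∩ C) / (L ∩ C^⊥)`, as the image of `L ∩ C` in `X^C = C / C^⊥`. -/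
def reduceSubspace (ω : BilinForm ℝ X) (C L : Submodule ℝ X) : Submodule ℝ (ReducedSpace ω C) :=
  (L.submoduleOf C).map ((ω.orthogonal C).submoduleOf C).mkQ

theorem isLagrangian_reduceSubspace [FiniteDimensional ℝ X] {ω : BilinForm ℝ X}
    (hω : IsSymplectic ω) {C : Submodule ℝ X} (hC : IsCoisotropic ω C) {L : Submodule ℝ X}
    (hL : IsLagrangian ω L) : IsLagrangian (reducedForm hω C) (reduceSubspace ω C L) := by
  have hoo := LinearMap.BilinForm.orthogonal_orthogonal hω.nondegenerate hω.alt.isRefl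
  apply le_antisymm
  · intro x hx
    obtain ⟨x, rfl⟩ := Submodule.Quotient.mk_surjective _ x
    have hsup : ω.orthogonal (L ⊓ C) ≤ L ⊔ ω.orthogonal C := by
      rw [← hoo (L ⊔ ω.orthogonal C)]
      refine LinearMap.BilinForm.orthogonal_le (le_inf ?_ ?_)
      · exact (LinearMap.BilinForm.orthogonal_le le_sup_left).trans (le_of_eq hL)
      · exact (LinearMap.BilinForm.orthogonal_le le_sup_right).trans (le_of_eq (hoo C))
    have hx' : (x : X) ∈ ω.orthogonal (L ⊓ C) := fun y hy =>
      hx (Submodule.Quotient.mk ⟨y, hy.2⟩) ⟨⟨y, hy.2⟩, hy.1, rfl⟩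
    obtain ⟨l, hl, c, hc, hlc⟩ := Submodule.mem_sup.1 (hsup hx')
    have hlC : l ∈ C := by
      have : l = x - c := by rw [← hlc]; abel
      rw [this]
      exact C.sub_mem x.2 (hC hc)
    refine ⟨⟨l, hlC⟩, hl, ?_⟩
    refine (Submodule.Quotient.eq _).2 ?_
    change l - (x : X) ∈ ω.orthogonal C
    have : l - (x : X) = -c := by rw [← hlc]; abel
    rw [this]
    exact Submodule.neg_mem _ hc
  · rintro _ ⟨x, hx, rfl⟩ _ ⟨y, hy, rfl⟩
    have hx' : (x : X) ∈ ω.orthogonal L := by rw [hL]; exact hx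
    exact hx' y hy

/-- The excess `𝓔^C(L) = dim (L ∩ C^⊥)`. -/
noncomputable def excess {ω : BilinForm ℝ X} (C : Submodule ℝ X) (L : LagrangianGrassmannian ω) :
    ℕ :=
  Module.finrank ℝ (L.1 ⊓ ω.orthogonal C : Submodule ℝ X)

theorem excess_le [FiniteDimensional ℝ X] {ω : BilinForm ℝ X} (C : Submodule ℝ X)
    (L : LagrangianGrassmannian ω) : excess C L ≤ Module.finrank ℝ (ω.orthogonal C) :=
  Submodule.finrank_mono inf_le_right

/-- The indexed reduction `𝓛_•(X) → 𝓛_•(X^C)`, `(L, k) ↦ (L^C, k + 𝓔^C(L))`. -/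
noncomputable def indexedReduction [FiniteDimensional ℝ X] {ω : BilinForm ℝ X}
    (hω : IsSymplectic ω) {C : Submodule ℝ X} (hC : IsCoisotropic ω C)
    (p : IndexedLagrangian ω) : IndexedLagrangian (reducedForm hω C) where
  lagrangian := ⟨reduceSubspace ω C p.lagrangian.1,
    isLagrangian_reduceSubspace hω hC p.lagrangian.2⟩
  index := p.index + excess C p.lagrangian

/-- The restricted indexed reduction `𝓛(X) → 𝓛_{≤ r}(X^C)`, `L ↦ (L^C, 𝓔^C(L))`, with
`r = dim C^⊥`; here `L` is regarded as the element `(L, 0)` of `𝓛_•(X)`. -/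
noncomputable def restrictedReduction [FiniteDimensional ℝ X] {ω : BilinForm ℝ X}
    (hω : IsSymplectic ω) {C : Submodule ℝ X} (hC : IsCoisotropic ω C)
    (L : LagrangianGrassmannian ω) :
    TruncatedIndexedLagrangian (reducedForm hω C) (Module.finrank ℝ (ω.orthogonal C)) :=
  ⟨indexedReduction hω hC ⟨L, 0⟩, (Nat.zero_add _).trans_le (excess_le C L)⟩

end Reduction

end Symplectic

/-! Everything is done by moving `L` with symplectic maps close to the identity. Such maps reach all
Lagrangians near `L` (`eventually_exists_symplectic_map`).

Openness. Symplectic maps of `X^C` near 1 lift to `X` (`eventually_exists_lift`), so every `M` near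
`L^C` is the reduction of some Lagrangian near `L` with the same excess. From there an arbitrarily
small rank-one or rank-two perturbation lowers the excess by one, either keeping the reduction or
bringing it at least one step closer to a prescribed target. Iterating (`exists_mem_reduction_eq`)
reaches every point of the sublevel set of `(L^C, 𝓔^C(L))` from any neighborhood of `L`, so images
of open sets contain basic Sabot neighborhoods. Surjectivity is the same descent, begun at the
preimage of `M` in `C`, whose excess is `r`.

Continuity. Reduction is continuous where the excess vanishes, i.e. where `L` is transverse to `C`
(`eventually_reduction_mem`). In general a product `J` of `𝓔^C(L)` transvections makes the excess
zero without changing `L^C`, and fixes a subspace of codimension at most `𝓔^C(L)`. For `L'` near `L`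
a dimension count gives `d((JL')^C, L'^C) + 𝓔^C(L') ≤ 𝓔^C(L)`, while `(JL')^C` is near `L^C`; the
triangle inequality then gives openness of the preimages of the generating sets. -/

namespace Symplectic

open Filter Topology

/-! ### Neighborhoods in the module topology; matrices acting on tuples. -/

section LinearNeighborhoods

variable {E F : Type*} [AddCommGroup E] [Module ℝ E] [AddCommGroup F] [Module ℝ F]

/-- The neighborhood filter of a point for the module topology of a real vector space. -/
def linNhds (x : E) : Filter E := @nhds E (moduleTopology ℝ E) x

theorem linNhds_eq_nhds [TopologicalSpace E] [IsModuleTopology ℝ E] (x : E) :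
    linNhds x = 𝓝 x := by
  rw [linNhds, ← eq_moduleTopology ℝ E]

theorem tendsto_linear (f : E →ₗ[ℝ] F) (x : E) : Tendsto f (linNhds x) (linNhds (f x)) := by
  let : TopologicalSpace E := moduleTopology ℝ E
  let : TopologicalSpace F := moduleTopology ℝ F
  have : IsModuleTopology ℝ E := ⟨rfl⟩
  have : IsModuleTopology ℝ F := ⟨rfl⟩
  have := IsModuleTopology.toContinuousAdd ℝ F
  exact (IsModuleTopology.continuous_of_linearMap f).tendsto x

theorem tendsto_affine (c : F) (f : E →ₗ[ℝ] F) (x : E) :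
    Tendsto (fun y => c + f y) (linNhds x) (linNhds (c + f x)) := by
  let : TopologicalSpace F := moduleTopology ℝ F
  have : IsModuleTopology ℝ F := ⟨rfl⟩
  have := IsModuleTopology.toContinuousAdd ℝ F
  exact ((continuous_const.add continuous_id).tendsto (f x)).comp (tendsto_linear f x)

/-- Right multiplication of a tuple of vectors by a matrix. -/
def tupleMul {d : ℕ} (A : Matrix (Fin d) (Fin d) ℝ) : (Fin d → E) →ₗ[ℝ] (Fin d → E) :=
  LinearMap.pi fun k => ∑ j, A j k • LinearMap.proj j

theorem tupleMul_apply {d : ℕ} (A : Matrix (Fin d) (Fin d) ℝ) (v : Fin d → E) (k : Fin d) :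
    tupleMul A v k = ∑ j, A j k • v j := by
  simp [tupleMul]

theorem tupleMul_tupleMul {d : ℕ} (A B : Matrix (Fin d) (Fin d) ℝ) (v : Fin d → E) :
    tupleMul B (tupleMul A v) = tupleMul (A * B) v := by
  ext k
  simp only [tupleMul_apply, Matrix.mul_apply, Finset.smul_sum, Finset.sum_smul, smul_smul]
  rw [Finset.sum_comm]
  simp only [mul_comm]

theorem tupleMul_one {d : ℕ} (v : Fin d → E) : tupleMul 1 v = v := by
  ext k
  simp [tupleMul_apply, Matrix.one_apply]

theorem span_tupleMul_le {d : ℕ} (A : Matrix (Fin d) (Fin d) ℝ) (v : Fin d → E) :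
    Submodule.span ℝ (Set.range (tupleMul A v)) ≤ Submodule.span ℝ (Set.range v) := by
  rw [Submodule.span_le]
  rintro _ ⟨k, rfl⟩
  rw [tupleMul_apply]
  exact Submodule.sum_mem _ fun j _ => Submodule.smul_mem _ _ (Submodule.subset_span ⟨j, rfl⟩)

theorem span_tupleMul {d : ℕ} {A B : Matrix (Fin d) (Fin d) ℝ} (h : A * B = 1) (v : Fin d → E) :
    Submodule.span ℝ (Set.range (tupleMul A v)) = Submodule.span ℝ (Set.range v) := by
  refine le_antisymm (span_tupleMul_le A v) ?_
  have := span_tupleMul_le B (tupleMul A v)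
  rwa [tupleMul_tupleMul, h, tupleMul_one] at this

theorem linearIndependent_of_span_eq {d : ℕ} {v w : Fin d → E} (hv : LinearIndependent ℝ v)
    (h : Submodule.span ℝ (Set.range w) = Submodule.span ℝ (Set.range v)) :
    LinearIndependent ℝ w := by
  rw [linearIndependent_iff_card_eq_finrank_span] at hv ⊢
  rw [hv, Set.finrank, Set.finrank, h]

theorem exists_tupleMul_eq {d : ℕ} {v w : Fin d → E}
    (h : Set.range w ⊆ Submodule.span ℝ (Set.range v)) :
    ∃ A : Matrix (Fin d) (Fin d) ℝ, tupleMul A v = w := by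
  have : ∀ k, ∃ c : Fin d → ℝ, ∑ j, c j • v j = w k := fun k =>
    (Submodule.mem_span_range_iff_exists_fun ℝ).1 (h ⟨k, rfl⟩)
  choose c hc using this
  exact ⟨Matrix.of fun j k => c k j, funext fun k => by rw [tupleMul_apply]; exact hc k⟩

theorem eq_one_of_tupleMul_eq {d : ℕ} {v : Fin d → E} (hv : LinearIndependent ℝ v)
    {A : Matrix (Fin d) (Fin d) ℝ} (h : tupleMul A v = v) : A = 1 := by
  ext j k
  have h1 : ∑ j, (A j k - (1 : Matrix (Fin d) (Fin d) ℝ) j k) • v j = 0 := by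
    have h2 := congrFun h k
    have h3 := congrFun (tupleMul_one v) k
    rw [tupleMul_apply] at h2 h3
    simp only [sub_smul, Finset.sum_sub_distrib, h2, h3, sub_self]
  exact sub_eq_zero.1 (Fintype.linearIndependent_iff.1 hv _ h1 j)

/-- The matrix of the images of a tuple of vectors under a coordinate map. -/
def coordMatrix {d : ℕ} (φ : E →ₗ[ℝ] (Fin d → ℝ)) :
    (Fin d → E) →ₗ[ℝ] Matrix (Fin d) (Fin d) ℝ where
  toFun v := Matrix.of fun i j => φ (v j) i
  map_add' v w := by ext; simp
  map_smul' c v := by ext; simp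

/-- Multiplying by the inverse coordinate matrix normalizes a frame to have identity coordinates
while keeping its span. Inversion is continuous at the identity matrix, so the normalized frame
stays near `b`. -/
theorem tendsto_normalize {d : ℕ} (φ : E →ₗ[ℝ] (Fin d → ℝ)) (b : Fin d → E)
    (hb : coordMatrix φ b = 1) :
    Tendsto (fun v => tupleMul (coordMatrix φ v)⁻¹ v) (linNhds b) (linNhds b) := by
  let : TopologicalSpace E := moduleTopology ℝ E
  have : IsModuleTopology ℝ E := ⟨rfl⟩
  have := IsModuleTopology.toContinuousAdd ℝ E
  have : IsModuleTopology ℝ (Matrix (Fin d) (Fin d) ℝ) :=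
    inferInstanceAs (IsModuleTopology ℝ (Fin d → Fin d → ℝ))
  have h1 : Tendsto (coordMatrix φ) (𝓝 b) (𝓝 1) := by
    have := tendsto_linear (coordMatrix φ) b
    rwa [hb, linNhds_eq_nhds, linNhds_eq_nhds] at this
  have h2 : ContinuousAt (fun A : Matrix (Fin d) (Fin d) ℝ => A⁻¹) 1 := by
    apply continuousAt_matrix_inv
    simp only [Matrix.det_one, Ring.inverse_eq_inv']
    exact continuousAt_inv₀ one_ne_zero
  have h3 : Tendsto (fun v => (coordMatrix φ v)⁻¹) (𝓝 b) (𝓝 1) := by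
    have := h2.tendsto.comp h1
    rwa [inv_one] at this
  rw [linNhds_eq_nhds]
  conv => arg 3; rw [← tupleMul_one b]
  rw [tendsto_pi_nhds]
  intro k
  simp only [tupleMul_apply]
  refine tendsto_finsetSum _ fun j _ => Tendsto.smul ?_ (tendsto_pi_nhds.1 tendsto_id j)
  exact tendsto_pi_nhds.1 (tendsto_pi_nhds.1 h3 j) k

theorem eventually_det_coordMatrix_ne_zero {d : ℕ} (φ : E →ₗ[ℝ] (Fin d → ℝ)) (b : Fin d → E)
    (hb : coordMatrix φ b = 1) : ∀ᶠ v in linNhds b, (coordMatrix φ v).det ≠ 0 := by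
  have : IsModuleTopology ℝ (Matrix (Fin d) (Fin d) ℝ) :=
    inferInstanceAs (IsModuleTopology ℝ (Fin d → Fin d → ℝ))
  have h1 : Tendsto (coordMatrix φ) (linNhds b) (𝓝 1) := by
    have := tendsto_linear (coordMatrix φ) b
    rwa [hb, linNhds_eq_nhds (1 : Matrix (Fin d) (Fin d) ℝ)] at this
  have h2 : ContinuousAt (fun A : Matrix (Fin d) (Fin d) ℝ => A.det) 1 :=
    continuous_id.matrix_det.continuousAt
  exact h1.eventually (h2.eventually_ne (by simp))

theorem exists_smul_ne_zero_mem {A : Set E} {x : E} (hA : A ∈ linNhds x) (y : E) :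
    ∃ t : ℝ, t ≠ 0 ∧ x + t • y ∈ A := by
  have h := tendsto_affine x (LinearMap.toSpanSingleton ℝ E y) 0
  rw [map_zero, add_zero, linNhds_eq_nhds (0 : ℝ)] at h
  have h1 : ∀ᶠ t in 𝓝[≠] (0 : ℝ), x + t • y ∈ A := (h.eventually hA).filter_mono nhdsWithin_le_nhds
  obtain ⟨t, ht, ht0⟩ := (h1.and self_mem_nhdsWithin).exists
  exact ⟨t, ht0, ht⟩

end LinearNeighborhoods

/-! ### Neighborhoods in the Grassmannian in terms of frames. -/

section Grassmannian

variable {X : Type*} [AddCommGroup X] [Module ℝ X]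

theorem nhds_frame {d : ℕ} (v : Frame X d) : 𝓝 v = comap Subtype.val (linNhds v.1) := by
  let : TopologicalSpace (Fin d → X) := moduleTopology ℝ (Fin d → X)
  exact nhds_induced Subtype.val v

theorem isOpen_grassmann_iff {O : Set (Submodule ℝ X)} :
    IsOpen[grassmannTopology X] O ↔
      ∀ d : ℕ, IsOpen {v : Frame X d | v.span ∈ O} := by
  rw [isOpen_iSup_iff]
  exact forall_congr' fun d => isOpen_coinduced

/-- Two frames of one subspace differ by an invertible matrix, and multiplication by that matrix is
continuous on frames and preserves spans. -/
theorem isOpen_image_span {d : ℕ} {A : Set (Frame X d)} (hA : IsOpen A) :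
    IsOpen[grassmannTopology X] (Frame.span '' A) := by
  rw [isOpen_grassmann_iff]
  intro d'
  rw [isOpen_iff_mem_nhds]
  rintro v' ⟨v, hvA, hv⟩
  obtain rfl : d' = d := by
    have h1 := finrank_span_eq_card v.2
    have h2 := finrank_span_eq_card v'.2
    rw [Fintype.card_fin] at h1 h2
    rw [← h1, ← h2]
    exact congrArg (fun L : Submodule ℝ X => Module.finrank ℝ L) hv.symm
  have hv' : Submodule.span ℝ (Set.range v.1) = Submodule.span ℝ (Set.range v'.1) := hv
  obtain ⟨B, hB⟩ := exists_tupleMul_eq (v := v'.1) (w := v.1)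
    (by rw [← hv']; exact Submodule.subset_span)
  obtain ⟨B', hB'⟩ := exists_tupleMul_eq (v := v.1) (w := v'.1)
    (by rw [hv']; exact Submodule.subset_span)
  have hBB : B * B' = 1 := by
    apply eq_one_of_tupleMul_eq v'.2
    rw [← tupleMul_tupleMul, hB, hB']
  have hmem := hA.mem_nhds hvA
  rw [nhds_frame] at hmem ⊢
  obtain ⟨A', hA', hsub⟩ := hmem
  have ht := tendsto_linear (tupleMul (E := X) B) v'.1
  rw [hB] at ht
  refine ⟨_, ht hA', fun w hw => ?_⟩
  have hs := span_tupleMul hBB w.1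
  exact ⟨⟨tupleMul B w.1, linearIndependent_of_span_eq w.2 hs⟩, hsub hw, hs⟩

theorem nhds_grassmann {d : ℕ} (v : Frame X d) :
    @nhds _ (grassmannTopology X) v.span = map Frame.span (𝓝 v) := by
  let := grassmannTopology X
  refine le_antisymm ?_ ?_
  · refine IsOpenMap.nhds_le (fun A hA => isOpen_image_span hA) v
  · refine Continuous.tendsto (continuous_def.2 fun O hO => ?_) v
    exact isOpen_grassmann_iff.1 hO d

end Grassmannian

/-! ### Neighborhoods in the Lagrangian Grassmannian; shears. -/

section Lagrangian

variable {X : Type*} [AddCommGroup X] [Module ℝ X] {ω : BilinForm ℝ X}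

theorem nhds_lagrangian {d : ℕ} (v : Frame X d) (L : LagrangianGrassmannian ω) (h : v.span = L.1) :
    𝓝 L = comap (fun L : LagrangianGrassmannian ω => L.1) (map Frame.span (𝓝 v)) := by
  rw [← nhds_grassmann, h]
  let := grassmannTopology X
  exact nhds_induced Subtype.val L

theorem eventually_nhds_frame_of_mem {d : ℕ} (v : Frame X d) (L : LagrangianGrassmannian ω)
    (h : v.span = L.1) {U : Set (LagrangianGrassmannian ω)} (hU : U ∈ 𝓝 L) :
    ∀ᶠ w in linNhds v.1, LinearIndependent ℝ w → ∀ L' : LagrangianGrassmannian ω,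
      Submodule.span ℝ (Set.range w) = L'.1 → L' ∈ U := by
  rw [nhds_lagrangian v L h] at hU
  obtain ⟨O, hO, hsub⟩ := hU
  rw [mem_map, nhds_frame] at hO
  obtain ⟨A, hA, hAO⟩ := hO
  filter_upwards [hA] with w hw hwi L' hL'
  have h1 : Frame.span (⟨w, hwi⟩ : Frame X d) ∈ O := hAO (a := ⟨w, hwi⟩) hw
  apply hsub
  change L'.1 ∈ O
  rw [← hL']
  exact h1

theorem eventually_nhds_lagrangian {d : ℕ} (v : Frame X d) (L : LagrangianGrassmannian ω)
    (h : v.span = L.1) {P : (Fin d → X) → Prop} (hP : ∀ᶠ w in linNhds v.1, P w) :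
    ∀ᶠ L' in 𝓝 L, ∃ w : Fin d → X, LinearIndependent ℝ w ∧
      Submodule.span ℝ (Set.range w) = L'.1 ∧ P w := by
  rw [nhds_lagrangian v L h]
  refine ⟨Frame.span '' {w | P w.1}, image_mem_map ?_, ?_⟩
  · rw [nhds_frame]
    exact preimage_mem_comap hP
  · rintro L' ⟨w, hw, hL'⟩
    exact ⟨w.1, w.2, hL', hw⟩

/-- Lagrangian subspaces near `L` are images of `L` under linear maps near the identity which shear
along a given complement `N` of `L`. -/
theorem eventually_exists_shear [FiniteDimensional ℝ X] (L : LagrangianGrassmannian ω)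
    {N : Submodule ℝ X} (hN : IsCompl L.1 N) {A : Set (Module.End ℝ X)}
    (hA : A ∈ linNhds (1 : Module.End ℝ X)) :
    ∀ᶠ L' in 𝓝 L, ∃ g ∈ A, L.1.map g = L'.1 ∧ (∀ x ∈ N, g x = x) ∧ ∀ x, g x - x ∈ N := by
  set d := Module.finrank ℝ L.1
  let b := Module.finBasis ℝ L.1
  let b' : Fin d → X := fun j => b j
  have hb'i : LinearIndependent ℝ b' := b.linearIndependent.map' L.1.subtype (Submodule.ker_subtype _)
  have hb's : Submodule.span ℝ (Set.range b') = L.1 := by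
    have : Set.range b' = L.1.subtype '' Set.range b := by rw [← Set.range_comp]; rfl
    rw [this, Submodule.span_image, b.span_eq, Submodule.map_top, Submodule.range_subtype]
  -- Coordinates on `L`, extended by zero on `N`.
  let φ : X →ₗ[ℝ] (Fin d → ℝ) := b.equivFun.toLinearMap ∘ₗ L.1.projectionOnto N hN
  have hφN : ∀ x, φ x = 0 ↔ x ∈ N := fun x => by
    simp [φ, Submodule.projectionOnto_apply_eq_zero_iff]
  have hφb : coordMatrix φ b' = 1 := by
    ext i j
    simp [coordMatrix, φ, b', Matrix.one_apply, Finsupp.single_apply, eq_comm (a := i)]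
  let H : (Fin d → X) →ₗ[ℝ] Module.End ℝ X :=
    { toFun := fun v => (Fintype.linearCombination ℝ v) ∘ₗ φ
      map_add' := fun v w => by ext; simp [Fintype.linearCombination_apply, Finset.sum_add_distrib]
      map_smul' := fun c v => by
        ext x
        simp only [LinearMap.comp_apply, Fintype.linearCombination_apply, Pi.smul_apply,
          LinearMap.smul_apply, RingHom.id_apply, Finset.smul_sum]
        exact Finset.sum_congr rfl fun j _ => smul_comm _ _ _ }
  have hH : ∀ v x, H v x = ∑ j, φ x j • v j := fun v x => by
    simp [H, Fintype.linearCombination_apply]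
  have hφb' : ∀ j, φ (b' j) = Pi.single j 1 := fun j => by
    ext i
    have := congrFun (congrFun hφb i) j
    simpa [coordMatrix, Matrix.one_apply, Pi.single_apply] using this
  -- The shear is `1 - H b' + H u`: it sends `b' j` to `u j`, fixes `N`, and equals 1 at `u = b'`.
  -- With `u` normalized, `u j - b' j` lies in `ker φ = N`.
  have hlim := (tendsto_affine (1 - H b') H b').comp (tendsto_normalize φ b' hφb)
  rw [sub_add_cancel] at hlim
  have hev := (hlim.eventually hA).and (eventually_det_coordMatrix_ne_zero φ b' hφb)
  filter_upwards [eventually_nhds_lagrangian ⟨b', hb'i⟩ L hb's hev] with L' ⟨w, hwi, hwL, hwA, hdet⟩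
  set u := tupleMul (coordMatrix φ w)⁻¹ w with hu
  have hunit : IsUnit (coordMatrix φ w).det := isUnit_iff_ne_zero.2 hdet
  have huL : Submodule.span ℝ (Set.range u) = L'.1 := by
    rw [← hwL]
    exact span_tupleMul (Matrix.nonsing_inv_mul _ hunit) w
  have hφu : ∀ j, φ (u j) = Pi.single j 1 := fun j => by
    ext i
    have h1 := congrFun (congrFun (Matrix.mul_nonsing_inv (coordMatrix φ w) hunit) i) j
    rw [Matrix.mul_apply] at h1
    rw [hu, tupleMul_apply, map_sum, Finset.sum_apply]
    simp only [map_smul, Pi.smul_apply, smul_eq_mul]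
    rw [Pi.single_apply, ← Matrix.one_apply, ← h1]
    exact Finset.sum_congr rfl fun k _ => mul_comm _ _
  have hg : ∀ x, (1 - H b' + H u) x = x + ∑ j, φ x j • (u j - b' j) := fun x => by
    simp only [LinearMap.add_apply, LinearMap.sub_apply, Module.End.one_apply, hH, smul_sub,
      Finset.sum_sub_distrib]
    abel
  refine ⟨_, hwA, ?_, ?_, ?_⟩
  · change L.1.map (1 - H b' + H u) = L'.1
    rw [← hb's, Submodule.map_span, ← Set.range_comp, ← huL]
    congr 2
    ext1 j
    simp only [Function.comp_apply, hg, hφb']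
    simp [Pi.single_apply]
  · intro x hx
    change (1 - H b' + H u) x = x
    rw [hg, (hφN x).2 hx]
    simp
  · intro x
    change (1 - H b' + H u) x - x ∈ N
    rw [hg, add_sub_cancel_left]
    refine Submodule.sum_mem _ fun j _ => Submodule.smul_mem _ _ ((hφN _).1 ?_)
    rw [map_sub, hφu, hφb', sub_self]

end Lagrangian

/-! ### Dimension counts from rank-nullity. -/

section LinearAlgebra

variable {X Y : Type*} [AddCommGroup X] [Module ℝ X] [AddCommGroup Y] [Module ℝ Y]

theorem finrank_submoduleOf {S T : Submodule ℝ X} (h : S ≤ T) :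
    Module.finrank ℝ (S.submoduleOf T) = Module.finrank ℝ S :=
  (Submodule.submoduleOfEquivOfLe h).finrank_eq

theorem ker_domRestrict_eq_submoduleOf (f : X →ₗ[ℝ] Y) (S : Submodule ℝ X) :
    LinearMap.ker (f.domRestrict S) = (S ⊓ LinearMap.ker f).submoduleOf S := by
  ext x
  simp [Submodule.submoduleOf]

theorem finrank_map_add_finrank_inf_ker [FiniteDimensional ℝ X] (f : X →ₗ[ℝ] Y)
    (S : Submodule ℝ X) :
    Module.finrank ℝ (S.map f) + Module.finrank ℝ (S ⊓ LinearMap.ker f : Submodule ℝ X) =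
      Module.finrank ℝ S := by
  have h := LinearMap.finrank_range_add_finrank_ker (f.domRestrict S)
  rwa [LinearMap.range_domRestrict, ker_domRestrict_eq_submoduleOf,
    finrank_submoduleOf inf_le_left] at h

theorem finrank_inf_ker_add_one [FiniteDimensional ℝ X] (f : X →ₗ[ℝ] ℝ) {S : Submodule ℝ X}
    {x : X} (hx : x ∈ S) (hfx : f x ≠ 0) :
    Module.finrank ℝ (S ⊓ LinearMap.ker f : Submodule ℝ X) + 1 = Module.finrank ℝ S := by
  have h := finrank_map_add_finrank_inf_ker f S
  have htop : S.map f = ⊤ := by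
    rw [eq_top_iff]
    intro c _
    refine ⟨(c / f x) • x, S.smul_mem _ hx, ?_⟩
    simp [hfx]
  rw [htop, finrank_top, Module.finrank_self] at h
  omega

theorem finrank_le_finrank_inf_ker_add_one [FiniteDimensional ℝ X] (f : X →ₗ[ℝ] ℝ)
    (S : Submodule ℝ X) :
    Module.finrank ℝ S ≤ Module.finrank ℝ (S ⊓ LinearMap.ker f : Submodule ℝ X) + 1 := by
  have h := finrank_map_add_finrank_inf_ker f S
  have h1 := Submodule.finrank_le (S.map f)
  rw [Module.finrank_self] at h1
  omega

end LinearAlgebra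

/-! ### Algebra of Lagrangian subspaces. -/

section Lagrangian

variable {X : Type*} [AddCommGroup X] [Module ℝ X] {ω : BilinForm ℝ X}

theorem IsLagrangian.apply_eq_zero {L : Submodule ℝ X} (hL : IsLagrangian ω L) {x y : X}
    (hx : x ∈ L) (hy : y ∈ L) : ω x y = 0 := by
  have hy' : y ∈ ω.orthogonal L := by rw [hL]; exact hy
  exact hy' x hx

theorem IsLagrangian.mem {L : Submodule ℝ X} (hL : IsLagrangian ω L) {y : X}
    (h : ∀ x ∈ L, ω x y = 0) : y ∈ L := by
  rw [← hL]
  exact h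

theorem isLagrangian_mk {L : Submodule ℝ X} (h : ∀ x ∈ L, ∀ y ∈ L, ω x y = 0)
    (h' : ∀ y, (∀ x ∈ L, ω x y = 0) → y ∈ L) : IsLagrangian ω L :=
  le_antisymm (fun y hy => h' y hy) fun y hy x hx => h x hx y hy

theorem IsLagrangian.eq_of_le {L L' : Submodule ℝ X} (hL : IsLagrangian ω L)
    (hL' : IsLagrangian ω L') (h : L ≤ L') : L = L' :=
  le_antisymm h fun _ hy => hL.mem fun _ hx => hL'.apply_eq_zero (h hx) hy

theorem IsSymplectic.neg_apply (hω : IsSymplectic ω) (x y : X) : ω x y = -ω y x :=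
  (hω.alt.neg_eq y x).symm

theorem IsSymplectic.apply_eq_zero_comm (hω : IsSymplectic ω) {x y : X} (h : ω x y = 0) :
    ω y x = 0 := hω.alt.isRefl x y h

theorem IsLagrangian.finrank_add_self [FiniteDimensional ℝ X] (hω : IsSymplectic ω)
    {L : Submodule ℝ X} (hL : IsLagrangian ω L) :
    Module.finrank ℝ L + Module.finrank ℝ L = Module.finrank ℝ X := by
  have h := LinearMap.BilinForm.finrank_orthogonal hω.nondegenerate L
  have h1 := Submodule.finrank_le L
  have hL' : ω.orthogonal L = L := hL
  rw [hL'] at h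
  omega

theorem IsLagrangian.finrank_eq [FiniteDimensional ℝ X] (hω : IsSymplectic ω)
    {L L' : Submodule ℝ X} (hL : IsLagrangian ω L) (hL' : IsLagrangian ω L') :
    Module.finrank ℝ L = Module.finrank ℝ L' := by
  have h1 := hL.finrank_add_self hω
  have h2 := hL'.finrank_add_self hω
  omega

theorem IsSymplectic.exists_apply_eq [FiniteDimensional ℝ X] (hω : IsSymplectic ω)
    (f : X →ₗ[ℝ] ℝ) : ∃ v, ω v = f :=
  ⟨(LinearMap.BilinForm.toDual ω hω.nondegenerate).symm f, LinearMap.ext fun x =>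
    LinearMap.BilinForm.apply_toDual_symm_apply f x⟩

/-- Every Lagrangian subspace has a Lagrangian complement. -/
theorem IsLagrangian.exists_isCompl [FiniteDimensional ℝ X] (hω : IsSymplectic ω)
    {L : Submodule ℝ X} (hL : IsLagrangian ω L) :
    ∃ N : Submodule ℝ X, IsLagrangian ω N ∧ IsCompl L N := by
  -- A maximal isotropic subspace disjoint from `L` will be the complement.
  obtain ⟨N, ⟨hiso, hdisj⟩, hmax⟩ := WellFounded.has_min
    (wellFounded_gt (α := Submodule ℝ X))
    {N | (∀ x ∈ N, ∀ y ∈ N, ω x y = 0) ∧ Disjoint L N} ⟨⊥, by simp, disjoint_bot_right⟩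
  rw [Submodule.disjoint_def] at hdisj
  -- Otherwise adjoining such an `x` to `N` would contradict maximality.
  have hsup : ω.orthogonal N ≤ N ⊔ L := by
    intro x hx
    by_contra hxN
    refine hmax (N ⊔ Submodule.span ℝ {x}) ⟨?_, ?_⟩ ?_
    · intro y hy z hz
      obtain ⟨n, hn, _, hs, rfl⟩ := Submodule.mem_sup.1 hy
      obtain ⟨c, rfl⟩ := Submodule.mem_span_singleton.1 hs
      obtain ⟨m, hm, _, hs, rfl⟩ := Submodule.mem_sup.1 hz
      obtain ⟨d, rfl⟩ := Submodule.mem_span_singleton.1 hs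
      have h1 : ω n x = 0 := hx n hn
      have h2 : ω x m = 0 := hω.apply_eq_zero_comm (hx m hm)
      simp [hiso n hn m hm, h1, h2, hω.alt x]
    · rw [Submodule.disjoint_def]
      intro y hyL hy
      obtain ⟨n, hn, _, hs, rfl⟩ := Submodule.mem_sup.1 hy
      obtain ⟨c, rfl⟩ := Submodule.mem_span_singleton.1 hs
      by_cases hc : c = 0
      · subst hc
        rw [zero_smul, add_zero] at hyL ⊢
        exact hdisj n hyL hn
      · refine absurd ?_ hxN
        have : x = c⁻¹ • (-n + (n + c • x)) := by
          rw [neg_add_cancel_left, smul_smul, inv_mul_cancel₀ hc, one_smul]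
        rw [this]
        exact Submodule.smul_mem _ _ (add_mem (Submodule.mem_sup_left (N.neg_mem hn))
          (Submodule.mem_sup_right hyL))
    · refine lt_of_le_of_ne le_sup_left fun h => hxN ?_
      rw [h]
      exact Submodule.mem_sup_left (Submodule.mem_sup_right (Submodule.mem_span_singleton_self x))
  -- Such a `y` is orthogonal to `N + L ⊇ N^⊥`, hence lies in `N^⊥⊥ = N`, which is disjoint from
  -- `L`.
  have hinf : ∀ y ∈ ω.orthogonal N, y ∈ L → y = 0 := by
    intro y hy hyL
    refine hdisj y hyL ?_
    rw [← LinearMap.BilinForm.orthogonal_orthogonal hω.nondegenerate hω.alt.isRefl N]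
    intro z hz
    obtain ⟨n, hn, l, hl, rfl⟩ := Submodule.mem_sup.1 (hsup hz)
    have h1 : ω n y = 0 := hy n hn
    change ω (n + l) y = 0
    rw [map_add, LinearMap.add_apply, h1, hL.apply_eq_zero hl hyL, add_zero]
  have hN : IsLagrangian ω N := by
    refine isLagrangian_mk hiso fun y hy => ?_
    obtain ⟨n, hn, l, hl, rfl⟩ := Submodule.mem_sup.1 (hsup hy)
    have : l = 0 := hinf l (fun m hm => by
      have h1 := hy m hm
      rw [map_add, hiso m hm n hn, zero_add] at h1
      exact h1) hl
    rw [this, add_zero]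
    exact hn
  have hd : Disjoint L N := Submodule.disjoint_def.2 hdisj
  refine ⟨N, hN, hd, codisjoint_iff.2 (Submodule.eq_top_of_disjoint L N ?_ hd)⟩
  rw [hN.finrank_eq hω hL, hL.finrank_add_self hω]

/-! ### The discrete metric on Lagrangians. -/

section Distance

variable [FiniteDimensional ℝ X]

theorem lagrangianDist_add (L L' : LagrangianGrassmannian ω) :
    lagrangianDist L L' + Module.finrank ℝ (L.1 ⊓ L'.1 : Submodule ℝ X) =
      Module.finrank ℝ L.1 := by
  rw [lagrangianDist, ← finrank_submoduleOf (S := L.1 ⊓ L'.1) (T := L.1) inf_le_left]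
  exact Submodule.finrank_quotient_add_finrank _

theorem lagrangianDist_self (L : LagrangianGrassmannian ω) : lagrangianDist L L = 0 := by
  have := lagrangianDist_add L L
  rw [inf_idem] at this
  omega

theorem eq_of_lagrangianDist_eq_zero {L L' : LagrangianGrassmannian ω}
    (h : lagrangianDist L L' = 0) : L = L' := by
  have h1 := lagrangianDist_add L L'
  rw [h, zero_add] at h1
  exact Subtype.ext (L.2.eq_of_le L'.2 (inf_eq_left.1
    (Submodule.eq_of_le_of_finrank_eq inf_le_left h1)))

/-- `L₁ ∩ L₂` and `L₂ ∩ L₃` have their sum inside `L₂` and their intersection inside `L₁ ∩ L₃`; all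
Lagrangians have equal dimension. -/
theorem lagrangianDist_triangle (hω : IsSymplectic ω) (L₁ L₂ L₃ : LagrangianGrassmannian ω) :
    lagrangianDist L₁ L₃ ≤ lagrangianDist L₁ L₂ + lagrangianDist L₂ L₃ := by
  have h1 := lagrangianDist_add L₁ L₃
  have h2 := lagrangianDist_add L₁ L₂
  have h3 := lagrangianDist_add L₂ L₃
  have h4 := L₁.2.finrank_eq hω L₂.2
  have h5 := Submodule.finrank_sup_add_finrank_inf_eq (L₁.1 ⊓ L₂.1) (L₂.1 ⊓ L₃.1)
  have h6 : Module.finrank ℝ (L₁.1 ⊓ L₂.1 ⊔ L₂.1 ⊓ L₃.1 : Submodule ℝ X) ≤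
      Module.finrank ℝ L₂.1 := Submodule.finrank_mono (sup_le inf_le_right inf_le_left)
  have h7 : Module.finrank ℝ (L₁.1 ⊓ L₂.1 ⊓ (L₂.1 ⊓ L₃.1) : Submodule ℝ X) ≤
      Module.finrank ℝ (L₁.1 ⊓ L₃.1 : Submodule ℝ X) :=
    Submodule.finrank_mono (le_inf (inf_le_left.trans inf_le_left)
      (inf_le_right.trans inf_le_right))
  omega

end Distance

/-! ### Symplectic maps acting on Lagrangians. -/

section SymplecticMap

/-- A linear endomorphism preserving the form. -/
def IsSymplecticMap (ω : BilinForm ℝ X) (g : Module.End ℝ X) : Prop :=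
  ∀ x y, ω (g x) (g y) = ω x y

theorem IsSymplecticMap.injective (hω : IsSymplectic ω) {g : Module.End ℝ X}
    (hg : IsSymplecticMap ω g) : Function.Injective g := by
  rw [injective_iff_map_eq_zero]
  intro x hx
  refine hω.nondegenerate.1 x fun y => ?_
  rw [← hg x y, hx, map_zero, LinearMap.zero_apply]

theorem IsSymplecticMap.mul {g h : Module.End ℝ X} (hg : IsSymplecticMap ω g)
    (hh : IsSymplecticMap ω h) : IsSymplecticMap ω (g * h) := fun x y => by
  rw [Module.End.mul_apply, Module.End.mul_apply, hg, hh]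

theorem isSymplecticMap_one : IsSymplecticMap ω 1 := fun _ _ => rfl

variable [FiniteDimensional ℝ X]

/-- The action of symplectic maps on the Lagrangian Grassmannian. -/
def mapLagrangian (hω : IsSymplectic ω) {g : Module.End ℝ X} (hg : IsSymplecticMap ω g)
    (L : LagrangianGrassmannian ω) : LagrangianGrassmannian ω :=
  ⟨L.1.map g, by
    refine isLagrangian_mk ?_ fun y hy => ?_
    · rintro _ ⟨x, hx, rfl⟩ _ ⟨y, hy, rfl⟩
      rw [hg]
      exact L.2.apply_eq_zero hx hy
    · obtain ⟨z, rfl⟩ := LinearMap.injective_iff_surjective.1 (hg.injective hω) y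
      refine ⟨z, L.2.mem fun x hx => ?_, rfl⟩
      rw [← hg]
      exact hy _ ⟨x, hx, rfl⟩⟩

theorem lagrangianDist_map (hω : IsSymplectic ω) {g : Module.End ℝ X} (hg : IsSymplecticMap ω g)
    (L L' : LagrangianGrassmannian ω) :
    lagrangianDist (mapLagrangian hω hg L) (mapLagrangian hω hg L') = lagrangianDist L L' := by
  have h1 := lagrangianDist_add L L'
  have h2 := lagrangianDist_add (mapLagrangian hω hg L) (mapLagrangian hω hg L')
  have h3 : (mapLagrangian hω hg L).1 ⊓ (mapLagrangian hω hg L').1 = (L.1 ⊓ L'.1).map g :=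
    (Submodule.map_inf g (hg.injective hω)).symm
  rw [h3, ← (Submodule.equivMapOfInjective g (hg.injective hω) (L.1 ⊓ L'.1)).finrank_eq,
    (mapLagrangian hω hg L).2.finrank_eq hω L.2] at h2
  omega

end SymplecticMap

end Lagrangian

/-! ### Reduction and excess. -/

section Reduction

variable {X : Type*} [AddCommGroup X] [Module ℝ X] {ω : BilinForm ℝ X} {C : Submodule ℝ X}

/-- The projection of `C` onto the reduced space. -/
abbrev toReduced (ω : BilinForm ℝ X) (C : Submodule ℝ X) : C →ₗ[ℝ] ReducedSpace ω C :=
  ((ω.orthogonal C).submoduleOf C).mkQ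

theorem toReduced_eq_zero {x : C} : toReduced ω C x = 0 ↔ (x : X) ∈ ω.orthogonal C :=
  Submodule.Quotient.mk_eq_zero _

theorem mem_reduceSubspace {L : Submodule ℝ X} {x : C} (hx : (x : X) ∈ L) :
    toReduced ω C x ∈ reduceSubspace ω C L := ⟨x, hx, rfl⟩

theorem exists_of_mem_reduceSubspace {L : Submodule ℝ X} {y : ReducedSpace ω C}
    (hy : y ∈ reduceSubspace ω C L) : ∃ x : C, (x : X) ∈ L ∧ toReduced ω C x = y := hy

theorem toReduced_eq_of_sub_mem {x y : C} (h : (x : X) - y ∈ ω.orthogonal C) :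
    toReduced ω C x = toReduced ω C y :=
  (Submodule.Quotient.eq _).2 h

theorem apply_eq_zero_of_mem_orthogonal {x y : X} (hx : x ∈ C)
    (hy : y ∈ ω.orthogonal C) : ω x y = 0 := hy x hx

theorem exists_extend_toReduced (ω : BilinForm ℝ X) (C : Submodule ℝ X) :
    ∃ q : X →ₗ[ℝ] ReducedSpace ω C, ∀ x : C, q x = toReduced ω C x := by
  obtain ⟨q, hq⟩ := LinearMap.exists_extend (toReduced ω C)
  exact ⟨q, fun x => LinearMap.congr_fun hq x⟩

theorem exists_mem_inf_orthogonal_ne_zero {L : LagrangianGrassmannian ω} (h : 0 < excess C L) :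
    ∃ κ ∈ L.1, κ ∈ ω.orthogonal C ∧ κ ≠ 0 := by
  have hne : L.1 ⊓ ω.orthogonal C ≠ ⊥ := fun h0 => by
    rw [excess, h0, finrank_bot] at h
    exact h.ne rfl
  obtain ⟨κ, hκ, h0⟩ := Submodule.exists_mem_ne_zero_of_ne_bot hne
  exact ⟨κ, hκ.1, hκ.2, h0⟩

/-- The multiple `x ↦ x + t ω(v, x) v` of a symplectic transvection. -/
def transvection (ω : BilinForm ℝ X) (v : X) (t : ℝ) : Module.End ℝ X :=
  1 + t • (ω v).smulRight v

theorem transvection_apply (v : X) (t : ℝ) (x : X) :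
    transvection ω v t x = x + (t * ω v x) • v := by
  simp [transvection, smul_smul]

theorem isSymplecticMap_transvection (hω : IsSymplectic ω) (v : X) (t : ℝ) :
    IsSymplecticMap ω (transvection ω v t) := fun x y => by
  simp only [transvection_apply, map_add, LinearMap.add_apply, map_smul, LinearMap.smul_apply,
    smul_eq_mul, hω.alt v, hω.neg_apply x v]
  ring

variable [FiniteDimensional ℝ X]

/-- The reduction of a Lagrangian subspace, as a Lagrangian subspace of the reduced space. -/
def reduction (hω : IsSymplectic ω) (hC : IsCoisotropic ω C) (L : LagrangianGrassmannian ω) :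
    LagrangianGrassmannian (reducedForm hω C) :=
  ⟨reduceSubspace ω C L.1, isLagrangian_reduceSubspace hω hC L.2⟩

/-- Rank-nullity on `L ⊓ C`: as `C^⊥ ⊆ C`, the kernel of the projection there is `L ⊓ C^⊥`. -/
theorem finrank_reduceSubspace_add (hC : IsCoisotropic ω C) (L : Submodule ℝ X) :
    Module.finrank ℝ (reduceSubspace ω C L) +
      Module.finrank ℝ (L ⊓ ω.orthogonal C : Submodule ℝ X) =
      Module.finrank ℝ (L ⊓ C : Submodule ℝ X) := by
  obtain ⟨q, hq⟩ := exists_extend_toReduced ω C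
  have h := finrank_map_add_finrank_inf_ker q (L ⊓ C)
  have h1 : (L ⊓ C).map q = reduceSubspace ω C L := by
    ext y
    constructor
    · rintro ⟨x, hx, rfl⟩
      exact ⟨⟨x, hx.2⟩, hx.1, (hq ⟨x, hx.2⟩).symm⟩
    · rintro ⟨x, hx, rfl⟩
      exact ⟨x, ⟨hx, x.2⟩, hq x⟩
  have h2 : L ⊓ C ⊓ LinearMap.ker q = L ⊓ ω.orthogonal C := by
    ext x
    constructor
    · rintro ⟨hx, hx'⟩
      refine ⟨hx.1, ?_⟩
      rw [SetLike.mem_coe, LinearMap.mem_ker, hq ⟨x, hx.2⟩] at hx'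
      exact toReduced_eq_zero.1 hx'
    · rintro ⟨hx, hx'⟩
      refine ⟨⟨hx, hC hx'⟩, ?_⟩
      rw [SetLike.mem_coe, LinearMap.mem_ker, hq ⟨x, hC hx'⟩]
      exact toReduced_eq_zero.2 hx'
  rwa [h1, h2] at h

/-! ### Perturbations that lower the excess. -/

section Transvection

/-- Subtracting a multiple of `κ`, every class in `L^C` gets a representative in `L ⊓ C` killed by
`ω v`, which the transvection fixes. One inclusion suffices because both sides are Lagrangian. -/
theorem reduceSubspace_map_transvection (hω : IsSymplectic ω) (hC : IsCoisotropic ω C)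
    (L : LagrangianGrassmannian ω) {v κ : X} (t : ℝ) (hκL : κ ∈ L.1) (hκ : κ ∈ ω.orthogonal C)
    (hv : ω v κ ≠ 0) :
    reduction hω hC (mapLagrangian hω (isSymplecticMap_transvection hω v t) L) =
      reduction hω hC L := by
  symm
  refine Subtype.ext (IsLagrangian.eq_of_le (reduction hω hC L).2 (reduction hω hC _).2 ?_)
  intro y hy
  obtain ⟨x, hx, rfl⟩ := exists_of_mem_reduceSubspace hy
  set c := ω v x / ω v κ
  have hxC : (x : X) - c • κ ∈ C := sub_mem x.2 (C.smul_mem _ (hC hκ))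
  have h0 : ω v (x - c • κ) = 0 := by
    simp [c, hv]
  rw [toReduced_eq_of_sub_mem (y := ⟨(x : X) - c • κ, hxC⟩)
    (by rw [sub_sub_cancel]; exact Submodule.smul_mem _ _ hκ)]
  refine mem_reduceSubspace ⟨(x : X) - c • κ, sub_mem hx (L.1.smul_mem _ hκL), ?_⟩
  rw [transvection_apply, h0, mul_zero, zero_smul, add_zero]

/-- The new intersection with `C^⊥` is the old one cut by the hyperplane `ker (ω v)`, which misses
`κ`. For `x ∈ L` moved into `C^⊥`, pairing the image with `κ` forces `ω v x = 0`. -/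
theorem excess_map_transvection (hω : IsSymplectic ω) (hC : IsCoisotropic ω C)
    (L : LagrangianGrassmannian ω) {v κ : X} {t : ℝ} (ht : t ≠ 0) (hκL : κ ∈ L.1)
    (hκ : κ ∈ ω.orthogonal C) (hv : ω v κ ≠ 0) :
    excess C (mapLagrangian hω (isSymplecticMap_transvection hω v t) L) + 1 = excess C L := by
  rw [excess, excess, ← finrank_inf_ker_add_one (ω v) (Submodule.mem_inf.2 ⟨hκL, hκ⟩) hv]
  refine congrArg (fun S : Submodule ℝ X => Module.finrank ℝ S + 1) ?_
  ext y
  constructor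
  · rintro ⟨⟨x, hx, rfl⟩, hy⟩
    rw [transvection_apply] at hy ⊢
    have h1 := apply_eq_zero_of_mem_orthogonal (hC hκ) hy
    rw [map_add, L.2.apply_eq_zero hκL hx, zero_add, map_smul, smul_eq_mul, hω.neg_apply κ v,
      mul_neg, neg_eq_zero, mul_eq_zero, or_iff_left hv, mul_eq_zero, or_iff_right ht] at h1
    rw [h1, mul_zero, zero_smul, add_zero] at hy ⊢
    exact ⟨⟨hx, hy⟩, h1⟩
  · rintro ⟨⟨hx, hy⟩, h1⟩
    have h1 : ω v y = 0 := h1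
    refine ⟨⟨y, hx, ?_⟩, hy⟩
    rw [transvection_apply, h1, mul_zero, zero_smul, add_zero]

/-- A Lagrangian subspace with positive excess can be moved by an arbitrarily small amount so that
the excess drops by one and the reduction stays the same. -/
theorem exists_map_excess_succ (hω : IsSymplectic ω) (hC : IsCoisotropic ω C)
    (L : LagrangianGrassmannian ω) (h : 0 < excess C L) {A : Set (Module.End ℝ X)}
    (hA : A ∈ linNhds (1 : Module.End ℝ X)) :
    ∃ g ∈ A, ∃ hg : IsSymplecticMap ω g,
      reduction hω hC (mapLagrangian hω hg L) = reduction hω hC L ∧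
      excess C (mapLagrangian hω hg L) + 1 = excess C L := by
  obtain ⟨κ, hκL, hκ, h0⟩ := exists_mem_inf_orthogonal_ne_zero h
  have hv : ∃ v, ω v κ ≠ 0 := by
    by_contra! hv
    exact h0 (hω.nondegenerate.2 κ hv)
  obtain ⟨v, hv⟩ := hv
  obtain ⟨t, ht, htA⟩ := exists_smul_ne_zero_mem hA ((ω v).smulRight v)
  exact ⟨_, htA, isSymplecticMap_transvection hω v t,
    reduceSubspace_map_transvection hω hC L t hκL hκ hv,
    excess_map_transvection hω hC L ht hκL hκ hv⟩

/-- A Lagrangian subspace can be moved off `C^⊥` without changing its reduction, by a symplectic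
map fixing a subspace of codimension at most the excess. -/
theorem exists_map_excess_eq_zero (hω : IsSymplectic ω) (hC : IsCoisotropic ω C)
    (n : ℕ) (L : LagrangianGrassmannian ω) (h : excess C L = n) :
    ∃ (J : Module.End ℝ X) (hJ : IsSymplecticMap ω J) (F : Submodule ℝ X),
      (∀ x ∈ F, J x = x) ∧ Module.finrank ℝ X ≤ Module.finrank ℝ F + n ∧
      reduction hω hC (mapLagrangian hω hJ L) = reduction hω hC L ∧
      excess C (mapLagrangian hω hJ L) = 0 := by
  induction n generalizing L with
  | zero =>
    have hone : mapLagrangian hω isSymplecticMap_one L = L := Subtype.ext (Submodule.map_id _)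
    refine ⟨1, isSymplecticMap_one, ⊤, fun x _ => rfl, by rw [finrank_top]; rfl, ?_, ?_⟩
    · rw [hone]
    · rw [hone, h]
  | succ n ih =>
    obtain ⟨κ, hκL, hκ, h0⟩ := exists_mem_inf_orthogonal_ne_zero (by rw [h]; exact n.succ_pos)
    have hv : ∃ v, ω v κ ≠ 0 := by
      by_contra! hv
      exact h0 (hω.nondegenerate.2 κ hv)
    obtain ⟨v, hv⟩ := hv
    -- `J` need not be near the identity, so any nonzero parameter serves.
    have hT := isSymplecticMap_transvection hω v 1
    have h1 := reduceSubspace_map_transvection hω hC L 1 hκL hκ hv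
    have h2 := excess_map_transvection hω hC L one_ne_zero hκL hκ hv
    obtain ⟨J, hJ, F, hJF, hF, hr, he⟩ := ih (mapLagrangian hω hT L) (by omega)
    have hcomp : mapLagrangian hω (hJ.mul hT) L = mapLagrangian hω hJ (mapLagrangian hω hT L) :=
      Subtype.ext (Submodule.map_comp _ _ _)
    refine ⟨J * transvection ω v 1, hJ.mul hT, F ⊓ LinearMap.ker (ω v), ?_, ?_, ?_, ?_⟩
    · rintro x ⟨hx, hvx⟩
      have hvx : ω v x = 0 := hvx
      rw [Module.End.mul_apply, transvection_apply, hvx, mul_zero, zero_smul, add_zero, hJF x hx]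
    · have := finrank_le_finrank_inf_ker_add_one (ω v) F
      omega
    · rw [hcomp, hr, h1]
    · rw [hcomp, he]

/-- `J` fixes `L ∩ C ∩ F`, whose image in `X^C` therefore lies in both reductions; the projection is
injective on it since `JL ∩ C^⊥ = 0`. Its dimension is at least `dim (L ∩ C) - n = dim L^C + 𝓔^C(L)
- n`. In the application `J`, `F`, `n` come from a fixed Lagrangian and `L` varies near it. -/
theorem lagrangianDist_reduction_add_excess_le (hω : IsSymplectic ω) (hC : IsCoisotropic ω C)
    (L : LagrangianGrassmannian ω) {J : Module.End ℝ X} (hJ : IsSymplecticMap ω J)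
    {F : Submodule ℝ X} (hJF : ∀ x ∈ F, J x = x) {n : ℕ}
    (hF : Module.finrank ℝ X ≤ Module.finrank ℝ F + n)
    (he : ∀ x ∈ L.1.map J, x ∈ ω.orthogonal C → x = 0) :
    lagrangianDist (reduction hω hC (mapLagrangian hω hJ L)) (reduction hω hC L) +
      excess C L ≤ n := by
  have h1 := lagrangianDist_add (reduction hω hC (mapLagrangian hω hJ L)) (reduction hω hC L)
  have h2 := finrank_reduceSubspace_add hC L.1
  have h3 := (reduction hω hC (mapLagrangian hω hJ L)).2.finrank_eq
    (reducedForm_isSymplectic hω C) (reduction hω hC L).2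
  have h4 := Submodule.finrank_sup_add_finrank_inf_eq (L.1 ⊓ C) F
  have h5 := Submodule.finrank_le (L.1 ⊓ C ⊔ F)
  obtain ⟨q, hq⟩ := exists_extend_toReduced ω C
  have h6 := finrank_map_add_finrank_inf_ker q (L.1 ⊓ C ⊓ F)
  have h7 : L.1 ⊓ C ⊓ F ⊓ LinearMap.ker q = ⊥ := by
    rw [eq_bot_iff]
    rintro x ⟨⟨⟨hxL, hxC⟩, hxF⟩, hx⟩
    rw [SetLike.mem_coe, LinearMap.mem_ker, hq ⟨x, hxC⟩] at hx
    exact he x ⟨x, hxL, hJF x hxF⟩ (toReduced_eq_zero.1 hx)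
  have h8 : (L.1 ⊓ C ⊓ F).map q ≤
      (reduction hω hC (mapLagrangian hω hJ L)).1 ⊓ (reduction hω hC L).1 := by
    rintro _ ⟨x, ⟨⟨hxL, hxC⟩, hxF⟩, rfl⟩
    rw [hq ⟨x, hxC⟩]
    exact ⟨mem_reduceSubspace ⟨x, hxL, hJF x hxF⟩, mem_reduceSubspace hxL⟩
  have h9 := Submodule.finrank_mono h8
  rw [h7, finrank_bot] at h6
  change _ + Module.finrank ℝ (L.1 ⊓ ω.orthogonal C : Submodule ℝ X) ≤ n
  change _ = Module.finrank ℝ (reduceSubspace ω C L.1) at h3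
  omega

/-- A Lagrangian subspace with positive excess can be moved by an arbitrarily small amount so that
the excess drops by one and the reduction comes closer to a given Lagrangian subspace. -/
theorem exists_map_lagrangianDist_succ (hω : IsSymplectic ω) (hC : IsCoisotropic ω C)
    (L : LagrangianGrassmannian ω) (h : 0 < excess C L)
    (M : LagrangianGrassmannian (reducedForm hω C)) (hM : reduction hω hC L ≠ M)
    {A : Set (Module.End ℝ X)} (hA : A ∈ linNhds (1 : Module.End ℝ X)) :
    ∃ g ∈ A, ∃ hg : IsSymplecticMap ω g,
      lagrangianDist (reduction hω hC (mapLagrangian hω hg L)) M + 1 ≤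
        lagrangianDist (reduction hω hC L) M ∧
      excess C (mapLagrangian hω hg L) + 1 = excess C L := by
  obtain ⟨κ, hκL, hκ, h0⟩ := exists_mem_inf_orthogonal_ne_zero h
  have ha : ∃ a : C, toReduced ω C a ∈ M.1 ∧ toReduced ω C a ∉ (reduction hω hC L).1 := by
    by_contra! ha
    refine hM (Subtype.ext (M.2.eq_of_le (reduction hω hC L).2 fun y hy => ?_).symm)
    obtain ⟨a, rfl⟩ := Submodule.mkQ_surjective _ y
    exact ha a hy
  obtain ⟨a, haM, haL⟩ := ha
  -- Otherwise `a` would lie in `C^⊥` and its class would be zero, hence in `L^C`. This gives `b`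
  -- with `ω b κ ≠ 0` and `ω b a = 0`.
  have hκa : κ ∉ Submodule.span ℝ {(a : X)} := by
    rw [Submodule.mem_span_singleton]
    rintro ⟨s, hs⟩
    have hs0 : s ≠ 0 := fun hs0 => h0 (by rw [← hs, hs0, zero_smul])
    refine haL ?_
    have : toReduced ω C a = 0 := by
      rw [toReduced_eq_zero, ← inv_smul_smul₀ hs0 (a : X), hs]
      exact Submodule.smul_mem _ _ hκ
    rw [this]
    exact zero_mem _
  obtain ⟨f, hfκ, hfa⟩ := Submodule.exists_le_ker_of_notMem hκa
  obtain ⟨b, rfl⟩ := hω.exists_apply_eq f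
  have hba : ω b a = 0 := hfa (Submodule.mem_span_singleton_self _)
  have hab : ω a b = 0 := hω.apply_eq_zero_comm hba
  have haκ : ω a κ = 0 := apply_eq_zero_of_mem_orthogonal a.2 hκ
  -- The map `x ↦ ω(a,x) b + ω(b,x) a` is infinitesimally symplectic and, as `ω(a,b) = 0`, squares
  -- to zero; hence `1 + t •` this map is symplectic.
  obtain ⟨t, ht, htA⟩ := exists_smul_ne_zero_mem hA
    ((ω a).smulRight b + (ω b).smulRight (a : X))
  set g : Module.End ℝ X := 1 + t • ((ω a).smulRight b + (ω b).smulRight (a : X)) with hgdef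
  have hgx : ∀ x, g x = x + (t * ω a x) • b + (t * ω b x) • (a : X) := fun x => by
    simp [hgdef, smul_smul, add_assoc]
  have hg : IsSymplecticMap ω g := fun x y => by
    simp only [hgx, map_add, LinearMap.add_apply, map_smul, LinearMap.smul_apply,
      smul_eq_mul, hω.alt b, hω.alt (a : X), hab, hba, hω.neg_apply x b, hω.neg_apply x a]
    ring
  refine ⟨g, htA, hg, ?_, ?_⟩
  · have h1 := lagrangianDist_add (reduction hω hC (mapLagrangian hω hg L)) M
    have h2 := lagrangianDist_add (reduction hω hC L) M
    have h3 := (reduction hω hC (mapLagrangian hω hg L)).2.finrank_eq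
      (reducedForm_isSymplectic hω C) (reduction hω hC L).2
    -- Classes in `L^C ∩ M` pair to zero with `a` and, after correction by `κ`, with `b`, so they
    -- survive. The class of `a` is gained, since `g κ = κ + t ω(b,κ) a`.
    have hlt : (reduction hω hC L).1 ⊓ M.1 <
        (reduction hω hC (mapLagrangian hω hg L)).1 ⊓ M.1 := by
      refine lt_of_le_of_ne ?_ fun heq => ?_
      · rintro y ⟨hyL, hyM⟩
        refine ⟨?_, hyM⟩
        obtain ⟨x, hx, rfl⟩ := exists_of_mem_reduceSubspace hyL
        have hax : ω a x = 0 := M.2.apply_eq_zero haM hyM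
        set c := ω b x / ω b κ
        have hxC : (x : X) - c • κ ∈ C := sub_mem x.2 (C.smul_mem _ (hC hκ))
        have h0 : ω b (x - c • κ) = 0 := by
          simp [c, hfκ]
        have h0' : ω a (x - c • κ) = 0 := by
          rw [map_sub, map_smul, hax, haκ, smul_zero, sub_zero]
        rw [toReduced_eq_of_sub_mem (y := ⟨(x : X) - c • κ, hxC⟩)
          (by rw [sub_sub_cancel]; exact Submodule.smul_mem _ _ hκ)]
        refine mem_reduceSubspace ⟨(x : X) - c • κ, sub_mem hx (L.1.smul_mem _ hκL), ?_⟩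
        rw [hgx, h0, h0', mul_zero, zero_smul, zero_smul, add_zero, add_zero]
      · have haR : toReduced ω C a ∈ (reduction hω hC (mapLagrangian hω hg L)).1 ⊓ M.1 := by
          refine ⟨?_, haM⟩
          have hs : t * ω b κ ≠ 0 := mul_ne_zero ht hfκ
          have hgκ : g κ = κ + (t * ω b κ) • (a : X) := by
            rw [hgx, haκ, mul_zero, zero_smul, add_zero]
          have hm : toReduced ω C ⟨g κ, by
              rw [hgκ]; exact add_mem (hC hκ) (C.smul_mem _ a.2)⟩ ∈
              (reduction hω hC (mapLagrangian hω hg L)).1 :=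
            mem_reduceSubspace ⟨κ, hκL, rfl⟩
          rw [toReduced_eq_of_sub_mem (y := (t * ω b κ) • a)
            (by simpa [hgκ] using hκ), map_smul] at hm
          exact (Submodule.smul_mem_iff _ hs).1 hm
        rw [← heq] at haR
        exact haL haR.1
    have h4 := Submodule.finrank_lt_finrank_of_lt hlt
    omega
  · rw [excess, excess, ← finrank_inf_ker_add_one (ω b) (Submodule.mem_inf.2 ⟨hκL, hκ⟩) hfκ]
    refine congrArg (fun S : Submodule ℝ X => Module.finrank ℝ S + 1) ?_
    ext y
    constructor
    · rintro ⟨⟨x, hx, rfl⟩, hy⟩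
      rw [hgx] at hy ⊢
      have h1 := apply_eq_zero_of_mem_orthogonal (hC hκ) hy
      rw [map_add, map_add, L.2.apply_eq_zero hκL hx, zero_add, map_smul, map_smul,
        hω.apply_eq_zero_comm haκ, smul_zero, add_zero, smul_eq_mul, hω.neg_apply κ b,
        mul_neg, neg_eq_zero, mul_eq_zero, or_iff_left hfκ, mul_eq_zero, or_iff_right ht] at h1
      rw [h1, mul_zero, zero_smul, add_zero] at hy ⊢
      -- Otherwise `x ∈ L ∩ C` and its class is a nonzero multiple of that of `a`, which is not in
      -- `L^C`.
      have hbx : ω b x = 0 := by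
        by_contra hbx
        have hs : t * ω b x ≠ 0 := mul_ne_zero ht hbx
        have hxC : x ∈ C := by
          have := sub_mem (hC hy) (C.smul_mem (t * ω b x) a.2)
          rwa [add_sub_cancel_right] at this
        have hm : toReduced ω C ⟨x, hxC⟩ ∈ (reduction hω hC L).1 := mem_reduceSubspace hx
        rw [toReduced_eq_of_sub_mem (y := -((t * ω b x) • a)) (by simpa using hy), map_neg,
          map_smul, Submodule.neg_mem_iff] at hm
        exact haL ((Submodule.smul_mem_iff _ hs).1 hm)
      rw [hbx, mul_zero, zero_smul, add_zero] at hy ⊢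
      exact ⟨⟨hx, hy⟩, hbx⟩
    · rintro ⟨⟨hx, hy⟩, h1⟩
      have h1 : ω b y = 0 := h1
      have h2 : ω a y = 0 := apply_eq_zero_of_mem_orthogonal a.2 hy
      refine ⟨⟨y, hx, ?_⟩, hy⟩
      rw [hgx, h1, h2, mul_zero, zero_smul, zero_smul, add_zero, add_zero]

end Transvection

/-! ### Lifting symplectic maps and Lagrangians from the reduced space. -/

section Lift

/-- A section `σ` of `C → X^C` and the projection `p` of `X` onto `X^C` along the orthogonal of its
range. -/
theorem exists_section (hω : IsSymplectic ω) (C : Submodule ℝ X) :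
    ∃ (σ : ReducedSpace ω C →ₗ[ℝ] C) (p : X →ₗ[ℝ] ReducedSpace ω C),
      (∀ z, toReduced ω C (σ z) = z) ∧ (∀ x : C, p x = toReduced ω C x) ∧
      ∀ x z, ω x (σ z) = reducedForm hω C (p x) z := by
  have hred := reducedForm_isSymplectic hω C
  obtain ⟨σ, hσ⟩ := (toReduced ω C).exists_rightInverse_of_surjective (Submodule.range_mkQ _)
  have hσ' : ∀ z, toReduced ω C (σ z) = z := fun z => LinearMap.congr_fun hσ z
  let D := LinearMap.BilinForm.toDual (reducedForm hω C) hred.nondegenerate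
  -- `p x` represents the functional `z ↦ ω(x, σ z)` under the reduced form.
  let p : X →ₗ[ℝ] ReducedSpace ω C :=
    D.symm.toLinearMap ∘ₗ (C.subtype ∘ₗ σ).dualMap ∘ₗ ω
  have hp : ∀ x z, reducedForm hω C (p x) z = ω x (σ z) := fun x z =>
    LinearMap.BilinForm.apply_toDual_symm_apply (hB := hred.nondegenerate) _ z
  refine ⟨σ, p, hσ', fun x => ?_, fun x z => (hp x z).symm⟩
  refine sub_eq_zero.1 (hred.nondegenerate.1 _ fun z => ?_)
  rw [map_sub, LinearMap.sub_apply, hp, sub_eq_zero]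
  conv_rhs => rw [← hσ' z]
  rfl

/-- Symplectic maps of the reduced space near the identity lift to symplectic maps near the
identity, compatibly with the reduction and without changing the excess. -/
theorem eventually_exists_lift (hω : IsSymplectic ω) (hC : IsCoisotropic ω C)
    {A : Set (Module.End ℝ X)} (hA : A ∈ linNhds (1 : Module.End ℝ X)) :
    ∀ᶠ g in linNhds (1 : Module.End ℝ (ReducedSpace ω C)),
      ∀ hg : IsSymplecticMap (reducedForm hω C) g, ∃ g' ∈ A, ∃ hg' : IsSymplecticMap ω g',
      ∀ L, reduction hω hC (mapLagrangian hω hg' L) =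
          mapLagrangian (reducedForm_isSymplectic hω C) hg (reduction hω hC L) ∧
        excess C (mapLagrangian hω hg' L) = excess C L := by
  obtain ⟨σ, p, hσ, hp, hσp⟩ := exists_section hω C
  have hred := reducedForm_isSymplectic hω C
  -- `Λ 1 = σ p` projects onto the range of `σ`, so the lift `1 - Λ 1 + Λ g` acts as `g` on that
  -- range and as the identity on its orthogonal.
  let Λ : Module.End ℝ (ReducedSpace ω C) →ₗ[ℝ] Module.End ℝ X :=
    { toFun := fun h => C.subtype ∘ₗ σ ∘ₗ h ∘ₗ p
      map_add' := fun h h' => by ext; simp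
      map_smul' := fun c h => by ext; simp }
  have hlim := tendsto_affine (1 - Λ 1) Λ 1
  rw [sub_add_cancel] at hlim
  filter_upwards [hlim.eventually hA] with g hgA hg
  set g' : Module.End ℝ X := 1 - Λ 1 + Λ g
  have hg'x : ∀ x, g' x = x + σ (g (p x) - p x) := fun x => by
    simp only [g', Λ, LinearMap.add_apply, LinearMap.sub_apply, Module.End.one_apply,
      LinearMap.coe_mk, AddHom.coe_mk, LinearMap.comp_apply, Submodule.subtype_apply, map_sub,
      Submodule.coe_sub]
    abel
  have hσp' : ∀ x z, ω (σ z) x = reducedForm hω C z (p x) := fun x z => by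
    rw [hω.neg_apply, hσp, hred.neg_apply z]
  have hg' : IsSymplecticMap ω g' := fun x y => by
    have h1 := hg (p x) (p y)
    rw [hg'x, hg'x]
    simp only [map_add, LinearMap.add_apply, hσp', hσp, hp, hσ]
    simp only [map_sub, LinearMap.sub_apply, h1]
    ring
  have hg'C : ∀ x : C, g' x ∈ C := fun x => by
    rw [hg'x]
    exact add_mem x.2 (σ _).2
  have hg'r : ∀ x : C, toReduced ω C ⟨g' x, hg'C x⟩ = g (toReduced ω C x) := fun x => by
    have : (⟨g' x, hg'C x⟩ : C) = x + σ (g (p x) - p x) := Subtype.ext (hg'x x)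
    rw [this, map_add, hσ, hp, add_sub_cancel]
  have hg'K : ∀ x ∈ ω.orthogonal C, g' x = x := fun x hx => by
    have : p x = 0 := by
      rw [hp ⟨x, hC hx⟩]
      exact toReduced_eq_zero.2 hx
    rw [hg'x, this, map_zero, sub_zero, map_zero, Submodule.coe_zero, add_zero]
  refine ⟨g', hgA, hg', fun L => ⟨?_, ?_⟩⟩
  · symm
    refine Subtype.ext (IsLagrangian.eq_of_le (mapLagrangian hred hg _).2 (reduction hω hC _).2 ?_)
    rintro _ ⟨_, ⟨x, hx, rfl⟩, rfl⟩
    refine (hg'r x) ▸ mem_reduceSubspace ⟨x, hx, rfl⟩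
  · rw [excess, excess]
    refine congrArg (fun S : Submodule ℝ X => Module.finrank ℝ S) ?_
    ext y
    constructor
    · rintro ⟨⟨x, hx, rfl⟩, hy⟩
      have hxC : x ∈ C := by
        have := sub_mem (hC hy) (σ (g (p x) - p x)).2
        rwa [hg'x, add_sub_cancel_right] at this
      have hxK : x ∈ ω.orthogonal C := by
        have h1 := (toReduced_eq_zero (x := ⟨g' x, hg'C ⟨x, hxC⟩⟩)).2 hy
        rw [hg'r ⟨x, hxC⟩] at h1
        exact toReduced_eq_zero.1 ((injective_iff_map_eq_zero g).1 (hg.injective hred) _ h1)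
      rw [hg'K x hxK]
      exact ⟨hx, hxK⟩
    · rintro ⟨hx, hy⟩
      exact ⟨⟨y, hx, hg'K y hy⟩, hy⟩

/-- The preimage in `C` of a Lagrangian subspace of the reduced space. -/
theorem exists_reduction_eq (hω : IsSymplectic ω) (hC : IsCoisotropic ω C)
    (M : LagrangianGrassmannian (reducedForm hω C)) :
    ∃ L, reduction hω hC L = M ∧ excess C L = Module.finrank ℝ (ω.orthogonal C) := by
  let L : Submodule ℝ X := (M.1.comap (toReduced ω C)).map C.subtype
  have hKL : ω.orthogonal C ≤ L := fun x hx =>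
    ⟨⟨x, hC hx⟩, by
      rw [SetLike.mem_coe, Submodule.mem_comap, toReduced_eq_zero.2 hx]
      exact zero_mem _, rfl⟩
  have hL : IsLagrangian ω L := by
    refine isLagrangian_mk ?_ fun y hy => ?_
    · rintro _ ⟨x, hx, rfl⟩ _ ⟨y, hy, rfl⟩
      exact M.2.apply_eq_zero hx hy
    · have hyC : y ∈ C := by
        rw [← LinearMap.BilinForm.orthogonal_orthogonal hω.nondegenerate hω.alt.isRefl C]
        exact fun x hx => hy x (hKL hx)
      refine ⟨⟨y, hyC⟩, M.2.mem fun z hz => ?_, rfl⟩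
      obtain ⟨x, rfl⟩ := Submodule.mkQ_surjective _ z
      exact hy x ⟨x, hz, rfl⟩
  refine ⟨⟨L, hL⟩, Subtype.ext ?_, ?_⟩
  · symm
    refine IsLagrangian.eq_of_le M.2 (reduction hω hC ⟨L, hL⟩).2 fun y hy => ?_
    obtain ⟨x, rfl⟩ := Submodule.mkQ_surjective _ y
    exact mem_reduceSubspace ⟨x, hy, rfl⟩
  · change Module.finrank ℝ (L ⊓ ω.orthogonal C : Submodule ℝ X) = _
    rw [inf_eq_right.2 hKL]

end Lift

end Reduction

/-! ### Local transitivity and continuity of the symplectic action. -/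

section Lagrangian

variable {X : Type*} [AddCommGroup X] [Module ℝ X] [FiniteDimensional ℝ X] {ω : BilinForm ℝ X}

theorem exists_frame_span_eq (S : Submodule ℝ X) :
    ∃ v : Frame X (Module.finrank ℝ S), v.span = S := by
  let b := Module.finBasis ℝ S
  refine ⟨⟨fun j => b j, b.linearIndependent.map' S.subtype (Submodule.ker_subtype _)⟩, ?_⟩
  have : Set.range (fun j => (b j : X)) = S.subtype '' Set.range b := by
    rw [← Set.range_comp]
    rfl
  change Submodule.span ℝ (Set.range fun j => (b j : X)) = S
  rw [this, Submodule.span_image, b.span_eq, Submodule.map_top, Submodule.range_subtype]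

/-- Lagrangian subspaces near `L` are images of `L` under symplectic maps near the identity. -/
theorem eventually_exists_symplectic_map (hω : IsSymplectic ω) (L : LagrangianGrassmannian ω)
    {A : Set (Module.End ℝ X)} (hA : A ∈ linNhds (1 : Module.End ℝ X)) :
    ∀ᶠ L' in 𝓝 L, ∃ g ∈ A, ∃ hg : IsSymplecticMap ω g, mapLagrangian hω hg L = L' := by
  -- With `N` Lagrangian the shear is symplectic: `g x - x ∈ N` pairs trivially with `N`, and both
  -- `L` and `L'` are isotropic.
  obtain ⟨N, hN, hLN⟩ := L.2.exists_isCompl hω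
  filter_upwards [eventually_exists_shear L hLN hA] with L' ⟨g, hgA, hgL, hgN, hgsub⟩
  refine ⟨g, hgA, fun x y => ?_, Subtype.ext hgL⟩
  have hdec : ∀ x, ∃ l ∈ L.1, ∃ n ∈ N, l + n = x := fun x => by
    have hx : x ∈ L.1 ⊔ N := by rw [hLN.sup_eq_top]; trivial
    obtain ⟨l, hl, n, hn, h⟩ := Submodule.mem_sup.1 hx
    exact ⟨l, hl, n, hn, h⟩
  obtain ⟨l, hl, n, hn, rfl⟩ := hdec x
  obtain ⟨l', hl', n', hn', rfl⟩ := hdec y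
  have hmem : ∀ l ∈ L.1, g l ∈ L'.1 := fun l hl => hgL ▸ ⟨l, hl, rfl⟩
  have h1 : ω (g l) (g l') = 0 := L'.2.apply_eq_zero (hmem l hl) (hmem l' hl')
  have h2 : ω (g l) n' = ω l n' := by
    rw [← sub_eq_zero, ← LinearMap.sub_apply, ← map_sub]
    exact hN.apply_eq_zero (hgsub l) hn'
  have h3 : ω n (g l') = ω n l' := by
    rw [← sub_eq_zero, ← map_sub]
    exact hN.apply_eq_zero hn (hgsub l')
  simp only [map_add, LinearMap.add_apply, hgN n hn, hgN n' hn', h1, h2, h3,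
    L.2.apply_eq_zero hl hl']

/-- The action of symplectic maps on a Lagrangian subspace is continuous. -/
theorem eventually_mapLagrangian_mem (hω : IsSymplectic ω) (L : LagrangianGrassmannian ω)
    {g : Module.End ℝ X} (hg : IsSymplecticMap ω g) {U : Set (LagrangianGrassmannian ω)}
    (hU : U ∈ 𝓝 (mapLagrangian hω hg L)) :
    ∀ᶠ h in linNhds g, ∀ hh : IsSymplecticMap ω h, mapLagrangian hω hh L ∈ U := by
  obtain ⟨v, hv⟩ := exists_frame_span_eq L.1
  have hi : ∀ {h : Module.End ℝ X}, IsSymplecticMap ω h → LinearIndependent ℝ (fun j => h (v.1 j)) :=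
    fun hh => v.2.map' _ (LinearMap.ker_eq_bot.2 (hh.injective hω))
  have hs : ∀ h : Module.End ℝ X,
      Submodule.span ℝ (Set.range fun j => h (v.1 j)) = L.1.map h := fun h => by
    refine Eq.trans ?_ (congrArg (Submodule.map h) hv)
    change _ = Submodule.map h (Submodule.span ℝ (Set.range v.1))
    rw [Submodule.map_span, ← Set.range_comp]
    rfl
  let ev : Module.End ℝ X →ₗ[ℝ] (Fin (Module.finrank ℝ L.1) → X) :=
    LinearMap.pi fun j => LinearMap.applyₗ (v.1 j)
  have h1 := eventually_nhds_frame_of_mem (⟨_, hi hg⟩ : Frame X _) (mapLagrangian hω hg L)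
    (hs g) hU
  filter_upwards [(tendsto_linear ev g).eventually h1] with h hh hsymp
  exact hh (hi hsymp) _ (hs h)

theorem eventually_mapLagrangian_one_mem (hω : IsSymplectic ω) {L : LagrangianGrassmannian ω}
    {U : Set (LagrangianGrassmannian ω)} (hU : U ∈ 𝓝 L) :
    ∀ᶠ h in linNhds (1 : Module.End ℝ X),
      ∀ hh : IsSymplecticMap ω h, mapLagrangian hω hh L ∈ U := by
  apply eventually_mapLagrangian_mem hω L isSymplecticMap_one
  have : mapLagrangian hω isSymplecticMap_one L = L := Subtype.ext (Submodule.map_id _)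
  rwa [this]

/-- Near `L` one has `L' = hL` with `h` near 1, so `gL' = (gh)L` with `gh` near `g`: continuity in
the Lagrangian follows from continuity in the map. -/
theorem continuous_mapLagrangian (hω : IsSymplectic ω) {g : Module.End ℝ X}
    (hg : IsSymplecticMap ω g) : Continuous (mapLagrangian hω hg) := by
  rw [continuous_iff_continuousAt]
  intro L U hU
  have h1 := eventually_mapLagrangian_mem hω L hg hU
  have h2 := tendsto_linear (LinearMap.mulLeft ℝ g) (1 : Module.End ℝ X)
  rw [LinearMap.mulLeft_apply, mul_one] at h2
  rw [mem_map]
  filter_upwards [eventually_exists_symplectic_map hω L (h2.eventually h1)] with L' ⟨h, hh, hs, hL'⟩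
  have h3 : mapLagrangian hω hg L' = mapLagrangian hω (hg.mul hs) L := by
    rw [← hL']
    exact Subtype.ext (Submodule.map_comp _ _ _).symm
  change mapLagrangian hω hg L' ∈ U
  rw [h3]
  exact hh (hg.mul hs)

end Lagrangian

/-! ### Surjectivity, continuity and openness of the indexed reduction. -/

section Reduction

variable {X : Type*} [AddCommGroup X] [Module ℝ X] [FiniteDimensional ℝ X] {ω : BilinForm ℝ X}
  {C : Submodule ℝ X}

/-- The reduction is continuous at Lagrangian subspaces of zero excess, and these form an open
set. -/
theorem eventually_reduction_mem (hω : IsSymplectic ω) (hC : IsCoisotropic ω C)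
    {L : LagrangianGrassmannian ω} (hL : excess C L = 0)
    {U : Set (LagrangianGrassmannian (reducedForm hω C))} (hU : U ∈ 𝓝 (reduction hω hC L)) :
    ∀ᶠ L' in 𝓝 L, reduction hω hC L' ∈ U ∧ ∀ x ∈ L'.1, x ∈ ω.orthogonal C → x = 0 := by
  have hred := reducedForm_isSymplectic hω C
  have hinf : L.1 ⊓ ω.orthogonal C = ⊥ := Submodule.finrank_eq_zero.1 hL
  -- Zero excess means transversality: `(L + C)^⊥ = L ∩ C^⊥ = 0`.
  have hsup : L.1 ⊔ C = ⊤ := by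
    rw [← LinearMap.BilinForm.orthogonal_orthogonal hω.nondegenerate hω.alt.isRefl (L.1 ⊔ C),
      eq_top_iff]
    have : ω.orthogonal (L.1 ⊔ C) = ⊥ := by
      rw [eq_bot_iff, ← hinf]
      exact le_inf ((LinearMap.BilinForm.orthogonal_le le_sup_left).trans L.2.le)
        (LinearMap.BilinForm.orthogonal_le le_sup_right)
    rw [this, LinearMap.BilinForm.orthogonal_bot]
  -- A complement inside `C` makes the shears along it preserve `C`; it need not be Lagrangian here.
  obtain ⟨N, hNC, hN⟩ : ∃ N ≤ C, IsCompl L.1 N := by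
    obtain ⟨N', hN'⟩ := Submodule.exists_isCompl ((L.1).submoduleOf C)
    refine ⟨N'.map C.subtype, Submodule.map_subtype_le _ _, ?_, ?_⟩
    · rw [Submodule.disjoint_def]
      rintro _ hx ⟨x, hx', rfl⟩
      rw [Submodule.disjoint_def.1 hN'.disjoint x hx hx', map_zero]
    · rw [codisjoint_iff, eq_top_iff, ← hsup]
      refine sup_le le_sup_left fun x hx => ?_
      have hx' : (⟨x, hx⟩ : C) ∈ L.1.submoduleOf C ⊔ N' := by rw [hN'.sup_eq_top]; trivial
      obtain ⟨l, hl, n, hn, h⟩ := Submodule.mem_sup.1 hx'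
      exact Submodule.mem_sup.2 ⟨l, hl, n, ⟨n, hn, rfl⟩, congrArg Subtype.val h⟩
  obtain ⟨q, hq⟩ := exists_extend_toReduced ω C
  obtain ⟨w, hw⟩ := exists_frame_span_eq (reduction hω hC L).1
  have hwL : ∀ j, ∃ c : C, (c : X) ∈ L.1 ∧ toReduced ω C c = w.1 j := fun j =>
    exists_of_mem_reduceSubspace (L := L.1) (hw.le (Submodule.subset_span ⟨j, rfl⟩))
  choose c hcL hcw using hwL
  let ev : Module.End ℝ X →ₗ[ℝ] (Fin (Module.finrank ℝ (reduction hω hC L).1) →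
      ReducedSpace ω C) := LinearMap.pi fun j => q ∘ₗ LinearMap.applyₗ (c j : X)
  have hev : ev 1 = w.1 := by
    ext1 j
    exact (hq (c j)).trans (hcw j)
  have h1 := tendsto_linear ev 1
  rw [hev] at h1
  filter_upwards [eventually_exists_shear L hN
    (h1.eventually (eventually_nhds_frame_of_mem w _ hw hU))] with L' ⟨g, hgU, hgL, hgN, hgsub⟩
  have hgL' : ∀ x ∈ L.1, g x ∈ L'.1 := fun x hx => hgL ▸ ⟨x, hx, rfl⟩
  have hgC : ∀ x : C, g x ∈ C := fun x => by
    have := add_mem x.2 (hNC (hgsub x))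
    rwa [add_sub_cancel] at this
  -- For `l ∈ L`, both `g l ∈ L'` and `g l - l ∈ N ⊆ C` are orthogonal to such a vector, so `l` is
  -- too; it thus lies in `L ∩ C^⊥ = 0`.
  have hL' : ∀ x ∈ L'.1, x ∈ ω.orthogonal C → x = 0 := by
    intro y hyL hyK
    have hy : y ∈ L.1 ⊓ ω.orthogonal C := by
      refine ⟨L.2.mem fun l hl => ?_, hyK⟩
      have h2 : ω (g l) y = 0 := L'.2.apply_eq_zero (hgL' l hl) hyL
      have h3 : ω (g l - l) y = 0 := hyK _ (hNC (hgsub l))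
      rwa [map_sub, LinearMap.sub_apply, h2, zero_sub, neg_eq_zero] at h3
    rwa [hinf] at hy
  refine ⟨?_, hL'⟩
  have hevg : ∀ j, ev g j = toReduced ω C ⟨g (c j), hgC _⟩ := fun j => hq ⟨g (c j), hgC _⟩
  have hginj : ∀ x ∈ L.1, g x = 0 → x = 0 := fun x hx h0 => by
    have h2 := hgsub x
    rw [h0, zero_sub, Submodule.neg_mem_iff] at h2
    exact Submodule.disjoint_def.1 hN.disjoint x hx h2
  -- A relation among the classes of `g (c j)` puts a vector of `L'` into `C^⊥`; it vanishes, and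
  -- injectivity of `g` on `L` turns this into a relation among the `w j`.
  have hli : LinearIndependent ℝ (ev g) := by
    rw [Fintype.linearIndependent_iff]
    intro a ha
    have hz : toReduced ω C ⟨g (∑ j, a j • (c j : X)), by
        have := hgC (∑ j, a j • c j)
        simpa using this⟩ = 0 := by
      rw [← ha]
      simp only [hevg, ← map_smul, ← map_sum]
      congr 1
      ext
      simp
    have hmem : ∑ j, a j • (c j : X) ∈ L.1 :=
      Submodule.sum_mem _ fun j _ => L.1.smul_mem _ (hcL j)
    have h0 := hginj _ hmem (hL' _ (hgL' _ hmem) (toReduced_eq_zero.1 hz))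
    have h2 : ∑ j, a j • w.1 j = 0 := by
      simp only [← hcw, ← map_smul, ← map_sum]
      rw [toReduced_eq_zero]
      simp [h0]
    exact Fintype.linearIndependent_iff.1 w.2 a h2
  refine hgU hli _ (Submodule.eq_of_le_of_finrank_eq ?_ ?_)
  · rw [Submodule.span_le]
    rintro _ ⟨j, rfl⟩
    rw [hevg]
    exact mem_reduceSubspace (hgL' _ (hcL j))
  · rw [finrank_span_eq_card hli, Fintype.card_fin]
    exact (reduction hω hC L).2.finrank_eq hred (reduction hω hC L').2

/-- Every element of the sublevel set of `(L^C, 𝓔^C(L))` is attained arbitrarily close to `L`. -/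
theorem exists_mem_reduction_eq (hω : IsSymplectic ω) (hC : IsCoisotropic ω C)
    (M : LagrangianGrassmannian (reducedForm hω C)) (j n : ℕ) (L : LagrangianGrassmannian ω)
    (hL : excess C L = j + n) (hd : lagrangianDist (reduction hω hC L) M ≤ n)
    {W : Set (LagrangianGrassmannian ω)} (hW : IsOpen W) (hLW : L ∈ W) :
    ∃ L' ∈ W, reduction hω hC L' = M ∧ excess C L' = j := by
  induction n generalizing L with
  | zero => exact ⟨L, hLW, eq_of_lagrangianDist_eq_zero (Nat.le_zero.1 hd), hL⟩
  | succ n ih =>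
    have hA := eventually_mapLagrangian_one_mem hω (hW.mem_nhds hLW)
    -- Once the target is reached the remaining excess is shed without moving the reduction. Each
    -- move stays in the open set `W`, so no bound on its size is needed.
    by_cases hM : reduction hω hC L = M
    · obtain ⟨g, hgA, hg, hr, he⟩ := exists_map_excess_succ hω hC L (by omega) hA
      refine ih _ (by omega) ?_ (hgA hg)
      rw [hr, hM, lagrangianDist_self]
      exact n.zero_le
    · obtain ⟨g, hgA, hg, hr, he⟩ := exists_map_lagrangianDist_succ hω hC L (by omega) M hM hA
      exact ih _ (by omega) (by omega) (hgA hg)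

theorem surjective_restrictedReduction (hω : IsSymplectic ω) (hC : IsCoisotropic ω C) :
    Function.Surjective (restrictedReduction hω hC) := by
  rintro ⟨⟨M, j⟩, hj⟩
  obtain ⟨L, hL, he⟩ := exists_reduction_eq hω hC M
  obtain ⟨n, hn⟩ := Nat.exists_eq_add_of_le hj
  obtain ⟨L', -, hL', he'⟩ := exists_mem_reduction_eq hω hC M j n L (he.trans hn)
    (by rw [hL, lagrangianDist_self]; exact n.zero_le) isOpen_univ (Set.mem_univ L)
  exact ⟨L', Subtype.ext (IndexedLagrangian.ext hL' ((Nat.zero_add _).trans he'))⟩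

/-- Take `J` making the excess of `L` zero. A `g` near 1 carries `L^C = (JL)^C` to `(JL')^C`; put
`M' = gM`. Then `d(M', (JL')^C) = d(M, L^C)`, and `lagrangianDist_reduction_add_excess_le` with the
triangle inequality finishes. -/
theorem eventually_exists_lagrangianDist_le (hω : IsSymplectic ω) (hC : IsCoisotropic ω C)
    (L : LagrangianGrassmannian ω) {M : LagrangianGrassmannian (reducedForm hω C)} {k : ℕ}
    (h : lagrangianDist M (reduction hω hC L) + excess C L ≤ k)
    {U : Set (LagrangianGrassmannian (reducedForm hω C))} (hU : U ∈ 𝓝 M) :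
    ∀ᶠ L' in 𝓝 L, ∃ M' ∈ U, lagrangianDist M' (reduction hω hC L') + excess C L' ≤ k := by
  have hred := reducedForm_isSymplectic hω C
  obtain ⟨J, hJ, F, hJF, hF, hr, he⟩ := exists_map_excess_eq_zero hω hC _ L rfl
  have h1 := eventually_exists_symplectic_map hred (reduction hω hC L)
    (eventually_mapLagrangian_one_mem hred hU)
  rw [← hr] at h1
  filter_upwards [(continuous_mapLagrangian hω hJ).continuousAt.eventually
    (eventually_reduction_mem hω hC he h1)] with L' ⟨⟨g, hgU, hg, hgL⟩, hL'⟩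
  refine ⟨mapLagrangian hred hg M, hgU hg, ?_⟩
  have h2 := lagrangianDist_reduction_add_excess_le hω hC L' hJ hJF hF hL'
  have h3 := lagrangianDist_triangle hred (mapLagrangian hred hg M)
    (reduction hω hC (mapLagrangian hω hJ L')) (reduction hω hC L')
  rw [← hgL, lagrangianDist_map, hgL, hr] at h3
  omega

theorem continuous_restrictedReduction (hω : IsSymplectic ω) (hC : IsCoisotropic ω C) :
    Continuous (restrictedReduction hω hC) := by
  refine Continuous.subtype_mk (continuous_generateFrom_iff.2 ?_) _
  rintro _ ⟨k, U, hU, rfl⟩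
  rw [isOpen_iff_mem_nhds]
  intro L hL
  obtain ⟨M, hM, hd⟩ := Set.mem_iUnion₂.1 hL
  have hd' : lagrangianDist M (reduction hω hC L) + (0 + excess C L) ≤ k := hd
  rw [zero_add] at hd'
  filter_upwards [eventually_exists_lagrangianDist_le hω hC L hd' (hU.mem_nhds hM)]
    with L' ⟨M', hM', h'⟩
  refine Set.mem_iUnion₂.2 ⟨M', hM', ?_⟩
  change lagrangianDist M' (reduction hω hC L') + (0 + excess C L') ≤ k
  rwa [zero_add]

theorem isOpenMap_restrictedReduction (hω : IsSymplectic ω) (hC : IsCoisotropic ω C) :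
    IsOpenMap (restrictedReduction hω hC) := by
  have hred := reducedForm_isSymplectic hω C
  intro W hW
  rw [isOpen_iff_mem_nhds]
  rintro _ ⟨L, hLW, rfl⟩
  have hev : ∀ᶠ M in 𝓝 (reduction hω hC L), ∃ L₁ ∈ W, reduction hω hC L₁ = M ∧
      excess C L₁ = excess C L := by
    filter_upwards [eventually_exists_symplectic_map hred (reduction hω hC L)
      (eventually_exists_lift hω hC (eventually_mapLagrangian_one_mem hω (hW.mem_nhds hLW)))]
      with M ⟨g, hgA, hg, hgM⟩
    obtain ⟨g', hgA', hg', h⟩ := hgA hg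
    exact ⟨_, hgA' hg', (h L).1.trans hgM, (h L).2⟩
  obtain ⟨U, hU, hUo, hLU⟩ := mem_nhds_iff.1 hev
  have hopen : IsOpen (⋃ M ∈ U, sublevel (⟨M, excess C L⟩ : IndexedLagrangian (reducedForm hω C))) :=
    TopologicalSpace.isOpen_generateFrom_of_mem ⟨_, U, hUo, rfl⟩
  refine mem_of_superset ((hopen.preimage continuous_subtype_val).mem_nhds ?_) ?_
  · refine Set.mem_iUnion₂.2 ⟨reduction hω hC L, hLU, ?_⟩
    change lagrangianDist (reduction hω hC L) (reduction hω hC L) + (0 + excess C L) ≤ excess C L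
    rw [lagrangianDist_self, zero_add, zero_add]
  · rintro ⟨⟨M', j⟩, hj⟩ hM'
    obtain ⟨M, hMU, hd⟩ := Set.mem_iUnion₂.1 hM'
    have hd : lagrangianDist M M' + j ≤ excess C L := hd
    obtain ⟨L₁, hL₁W, rfl, he⟩ := hU hMU
    -- The descent starts at `L₁`, whose reduction is exactly `M`, with `excess C L - j` drops
    -- available.
    obtain ⟨L', hL'W, hr, he'⟩ := exists_mem_reduction_eq hω hC M' j (excess C L - j) L₁
      (by omega) (by omega) hW hL₁W
    exact ⟨L', hL'W, Subtype.ext (IndexedLagrangian.ext hr ((Nat.zero_add _).trans he'))⟩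

end Reduction

end Symplectic

theorem mainTheorem11 {X : Type*} [AddCommGroup X] [Module ℝ X] [FiniteDimensional ℝ X]
    (ω : LinearMap.BilinForm ℝ X) (hω : Symplectic.IsSymplectic ω)
    (C : Submodule ℝ X) (hC : Symplectic.IsCoisotropic ω C) :
    Function.Surjective (Symplectic.restrictedReduction hω hC) ∧
    Continuous (Symplectic.restrictedReduction hω hC) ∧
    IsOpenMap (Symplectic.restrictedReduction hω hC) ∧
    Topology.IsQuotientMap (Symplectic.restrictedReduction hω hC) := by
  have hs := Symplectic.surjective_restrictedReduction hω hC
  have hc := Symplectic.continuous_restrictedReduction hω hC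
  have ho := Symplectic.isOpenMap_restrictedReduction hω hC
  exact ⟨hs, hc, ho, ho.isQuotientMap hc hs⟩
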